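/- Let $\Omega=\{1,2\}^{\mathbb Z}$ with the product order, product topology and product $\sigma$-algebra. For finite $A\subset\mathbb Z$ let $\eta_A\in\Omega$ be the configuration with $\eta_A(x)=2$ iff $x\in A$, and let $\Omega_f$ be the set of all $\eta_A$. For $\eta\in\Omega_f$ and $i\in\mathbb Z$ put $k^+=\min\{j\ge 0:\eta(i+j)=1\}$ and $k^-=\min\{j>0:\eta(i-j)=1\}$; the result of adding a grain at $i$ and toppling is $T_i\eta=\eta+e_i$ if $\eta(i)=1$, and $T_i\eta=\eta+e_{i+k^+}+e_{i-k^-}-e_{i+k^+-k^-}$ if $\eta(i)=2$. For $n\in\mathbb N$ let $S_n(t)$ be the transition semigroup of the (non-exploding) continuous-time Markov chain on $\Omega_f$ with generator $$L^{(n)}f(\eta)=\sum_{i:\,\eta(i)=2}[f(T_i\eta)-f(\eta)]+\sum_{|i|\le n,\ \eta(i)=1}[f(T_i\eta)-f(\eta)].$$ For $\eta\in\Omega$ let $\eta^k$ agree with $\eta$ on $[-k,k]$ and equal $1$ elsewhere. Call a family $(P^\eta)_{\eta\in\Omega}$ of probability measures on the path space $\Omega^{[0,\infty)}$, measurable in $\eta$,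 a sandpile process if it is a time-homogeneous Markov process and, for all $t\ge0$, $\eta\in\Omega$ and all continuous monotone $f:\Omega\to\mathbb R$, the limits below exist and $$\mathbb E^\eta f(\eta_t)=\lim_{n\to\infty}\lim_{k\to\infty}S_n(t)f(\eta^k).$$ Theorem 5.1. There is exactly one sandpile process $(P^\eta_{SP})_{\eta\in\Omega}$. There is a finite time $T$ with $0<T\le 14$ such that for all $t\ge T$ and all $\eta\in\Omega$, $$P^\eta_{SP}[\eta_t(0)=1]=0 .$$ Moreover, for all $t\ge T$ and all $\eta\in\Omega$ one has $P^\eta_{SP}[\eta_t\equiv 2]=1$, i.e. the law of $\eta_t$ under $P^\eta_{SP}$ is $\delta_2$, the Dirac measure at the configuration $\eta\equiv2$. Finally, $\delta_2$ is invariant for the sandpile process, and it is its only invariant probability measure. -/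

import Mathlib

open MeasureTheory ProbabilityTheory Filter Topology
open scoped NNReal ENNReal

noncomputable section

namespace Sandpile

/-- The possible heights of a stable site: `1`, or the threshold value `2`. -/
abbrev Height : Type := ({1, 2} : Set ℕ)

/-- The state space `Ω = {1,2}^ℤ`, with the product order, product topology and product
`σ`-algebra. -/
abbrev Config : Type := ℤ → Height

/-- The space `Ω^[0,∞)` of all paths, with the product `σ`-algebra. -/
abbrev PathSpace : Type := ℝ≥0 → Config

/-- The full configuration `η ≡ 2`. -/
def allTwo : Config := fun _ => ⟨2, by simp⟩

/-- The configuration `η_A` whose set of critical sites (height `2`) is the finite set `A`.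
The configurations with finitely many critical sites are exactly the `η_A`, and `A ↦ η_A` is
injective; below such configurations are therefore handled through `A`. -/
def ofFinset (A : Finset ℤ) : Config :=
  fun x => if x ∈ A then ⟨2, by simp⟩ else ⟨1, by simp⟩

/-- The critical sites of `η` in `[-k,k]`; `ofFinset (critIn η k)` agrees with `η` on `[-k,k]`
and equals `1` elsewhere. -/
def critIn (η : Config) (k : ℕ) : Finset ℤ :=
  (Finset.Icc (-(k : ℤ)) (k : ℤ)).filter fun x => (η x : ℕ) = 2

/-! ### The toppling map -/

/-- `k⁺(i, η_A) = min {j ≥ 0 : η_A (i + j) = 1}` (the set is nonempty as `A` is finite). -/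
def kPlus (i : ℤ) (A : Finset ℤ) : ℕ := sInf {j : ℕ | i + (j : ℤ) ∉ A}

/-- `k⁻(i, η_A) = min {j > 0 : η_A (i - j) = 1}` (the set is nonempty as `A` is finite). -/
def kMinus (i : ℤ) (A : Finset ℤ) : ℕ := sInf {j : ℕ | 0 < j ∧ i - (j : ℤ) ∉ A}

/-- The set of critical sites of `T_i η_A`, the result of adding a grain at `i` to `η_A` and
stabilizing. If `i ∉ A`, then `T_i η = η + e_i`; if `i ∈ A`, then
`T_i η = η + e_{i+k⁺} + e_{i-k⁻} - e_{i+k⁺-k⁻}`. -/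
def topple (i : ℤ) (A : Finset ℤ) : Finset ℤ :=
  if i ∈ A then
    insert (i + (kPlus i A : ℤ)) (insert (i - (kMinus i A : ℤ))
      (A.erase (i + (kPlus i A : ℤ) - (kMinus i A : ℤ))))
  else insert i A

/-! ### The auxiliary chain on finite sets: avalanches everywhere, births in `[-n,n]` -/

/-- The sites at which grains are added, at rate one each, when the state is `A`: all critical
sites (avalanches), and the noncritical sites of `[-n,n]` (births). -/
def activeSites (n : ℕ) (A : Finset ℤ) : Finset ℤ := A ∪ Finset.Icc (-(n : ℤ)) (n : ℤ)

/-- The total jump rate out of `A`. -/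
def rate (n : ℕ) (A : Finset ℤ) : ℝ := ((activeSites n A).card : ℝ)

/-- The probability that the continuous-time Markov chain with generator
`L⁽ⁿ⁾ f (A) = ∑ i ∈ activeSites n A, (f (topple i A) - f A)`, started from `A`, is in `B` at
time `t` after having made at most `m` jumps. The recursion conditions on the first jump. -/
def transIter (n : ℕ) (B : Finset ℤ) : ℕ → ℝ → Finset ℤ → ℝ≥0∞
  | 0, t, A => if A = B then ENNReal.ofReal (Real.exp (-(rate n A * t))) else 0
  | m + 1, t, A =>
      (if A = B then ENNReal.ofReal (Real.exp (-(rate n A * t))) else 0) +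
        ∫⁻ s in Set.Ioc 0 t, ENNReal.ofReal (Real.exp (-(rate n A * s))) *
          ∑ i ∈ activeSites n A, transIter n B m (t - s) (topple i A)

/-- The transition probability `p_t(A, B)` of the (non-exploding) continuous-time Markov chain
with generator `L⁽ⁿ⁾`, i.e. the minimal nonnegative solution of its backward equation. -/
def transProb (n : ℕ) (t : ℝ≥0) (A B : Finset ℤ) : ℝ≥0∞ := ⨆ m : ℕ, transIter n B m (t : ℝ) A

/-- The semigroup `S_n(t) f (η_A) = ∑_B p_t(A, B) f (η_B)` of that chain, for bounded `f`. -/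
def semigroup (n : ℕ) (t : ℝ≥0) (f : Config → ℝ) (A : Finset ℤ) : ℝ :=
  ∑' B : Finset ℤ, (transProb n t A B).toReal * f (ofFinset B)

/-! ### The sandpile process -/

/-- The `σ`-algebra generated by the coordinates `ω ↦ ω r`, `r ≤ t`. -/
abbrev past (t : ℝ≥0) : MeasurableSpace PathSpace :=
  ⨆ r : ℝ≥0, ⨆ _ : r ≤ t, MeasurableSpace.comap (fun ω : PathSpace => ω r) inferInstance

/-- `P`, a family `η ↦ P η` of measures on path space, depending measurably on `η`, is the
sandpile process: it is a time-homogeneous Markov process with values in `Config`, whose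
transition semigroup is `S(t) f (η) = lim_n lim_k S_n(t) f (η^k)`, where `η^k` agrees with `η`
on `[-k,k]` and equals `1` elsewhere. (For `t = 0` this says that the process starts at `η`.) -/
structure IsSandpileProcess (P : Kernel Config PathSpace) : Prop where
  isMarkovKernel : IsMarkovKernel P
  semigroup_eq : ∀ (t : ℝ≥0) (η : Config) (f : Config → ℝ), Continuous f → Monotone f →
    ∃ g : ℕ → ℝ,
      (∀ n, Tendsto (fun k => semigroup n t f (critIn η k)) atTop (𝓝 (g n))) ∧
      Tendsto g atTop (𝓝 (∫ ω, f (ω t) ∂(P η)))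
  markov : ∀ (η : Config) (s t : ℝ≥0) (A : Set PathSpace) (B : Set Config),
    MeasurableSet[past t] A → MeasurableSet B →
    P η (A ∩ {ω | ω (t + s) ∈ B}) = ∫⁻ ω in A, P (ω t) {ω' | ω' s ∈ B} ∂(P η)

/-- The transition kernel `η ↦` law of `η_t` under `P η`. -/
def timeMarginal (P : Kernel Config PathSpace) (t : ℝ≥0) : Kernel Config Config :=
  P.map (fun ω => ω t)

/-- `μ` is an invariant probability measure: if `η_0` has law `μ`, so has `η_t` for all `t`. -/
def IsInvariantMeasure (P : Kernel Config PathSpace) (μ : Measure Config) : Prop :=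
  IsProbabilityMeasure μ ∧ ∀ t : ℝ≥0, (timeMarginal P t).Invariant μ

end Sandpile

end

/-! Monotonicity. Every site of a block of critical sites receives grains at rate one, and an
avalanche started at `i` leaves its hole at the mirror image of `i` in the block. Indexing
avalanches by the hole instead of the grain therefore leaves the generator unchanged (`sum_holeAt`),
and `holeAt` preserves inclusion of configurations (`holeAt_mono`), which `topple` does not. Driving
two systems by the same clocks shows that expectations of monotone functions increase with the
initial state, the birth window and the box (`boxFlow_le_boxFlow`).

Existence and uniqueness. The sandpile on `[-N,N]`, with grains lost at the ends, has a finite state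
space, so its semigroup is a matrix exponential. The minimal chain is the limit of these as `N`
grows (`tendsto_boxFlow`): Fatou gives one inequality, and no mass is lost because each jump raises
the total rate by at most a bounded amount. For monotone `f` the box expectations increase with the
box, compactness of `Config` produces a limit law, and the chain expectations are squeezed between
the box expectations and this limit (`exists_tendsto_semigroup`). The same comparison gives
Chapman-Kolmogorov. The process is then built by Kolmogorov extension over space-time points. It is
unique because increasing cylinder indicators are continuous, monotone and measure-determining, so
the kernels, and with them the finite-dimensional laws, are forced.

Filling. By monotonicity it suffices to start a box empty. While `x` has not toppled, the sum over
the critical sites of a tent function with summit `x` grows at each grain by the tent at that grain;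
since this sum is bounded by its value on the full box, at least `N/4`, all sites have toppled by
time six except with exponentially small probability. Any two holes are separated by an untoppled
site (`Separated`), so then at most one hole is left. From there on a given site becomes the hole
for at most one grain position, and after one more unit of time the hole sits there with probability
of order `1/(2N+1)`. Letting `N` tend to infinity, the law is `δ_2` from time seven on, for every
initial state; invariance and uniqueness of the invariant measure follow. -/

noncomputable section

namespace Sandpile

/-! ### Jump semigroups on finite sets -/

section Flow

open NormedSpace

variable {X Y ι : Type*} [Fintype X] [Fintype Y]

/-- The operator `f ↦ ∑ j ∈ J, f ∘ φ j`. -/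
def sumComp (J : Finset ι) (φ : ι → X → X) : (X → ℝ) →L[ℝ] (X → ℝ) :=
  LinearMap.toContinuousLinearMap
    { toFun := fun f x => ∑ j ∈ J, f (φ j x)
      map_add' := fun f g => by ext x; simp [Finset.sum_add_distrib]
      map_smul' := fun c f => by ext x; simp [Finset.mul_sum] }

@[simp] lemma sumComp_apply (J : Finset ι) (φ : ι → X → X) (f : X → ℝ) (x : X) :
    sumComp J φ f x = ∑ j ∈ J, f (φ j x) := rfl

/-- The generator `f ↦ ∑ j ∈ J, (f ∘ φ j - f)` of the chain applying each `φ j` at rate one. -/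
def jumpGen (J : Finset ι) (φ : ι → X → X) : (X → ℝ) →L[ℝ] (X → ℝ) :=
  sumComp J φ - (J.card : ℝ) • 1

lemma jumpGen_apply (J : Finset ι) (φ : ι → X → X) (f : X → ℝ) (x : X) :
    jumpGen J φ f x = ∑ j ∈ J, (f (φ j x) - f x) := by
  simp [jumpGen, Finset.sum_sub_distrib]

/-- The semigroup of the chain applying each `φ j`, `j ∈ J`, at rate one. -/
def flow (J : Finset ι) (φ : ι → X → X) (t : ℝ) : (X → ℝ) →L[ℝ] (X → ℝ) :=
  exp (t • jumpGen J φ)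

lemma flow_zero (J : Finset ι) (φ : ι → X → X) : flow J φ 0 = 1 := by
  simp [flow]

lemma flow_add (J : Finset ι) (φ : ι → X → X) (s t : ℝ) (f : X → ℝ) :
    flow J φ (s + t) f = flow J φ s (flow J φ t f) := by
  let _ : NormedAlgebra ℚ ((X → ℝ) →L[ℝ] (X → ℝ)) := NormedAlgebra.restrictScalars ℚ ℝ _
  have : flow J φ (s + t) = flow J φ s * flow J φ t := by
    rw [flow, add_smul, exp_add_of_commute]
    · rfl
    · exact ((Commute.refl _).smul_left _).smul_right _
  rw [this]; rfl

lemma flow_congr {κ : Type*} {J : Finset ι} {φ : ι → X → X} {J' : Finset κ} {φ' : κ → X → X}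
    (h : ∀ (f : X → ℝ) (x : X), ∑ j ∈ J, (f (φ j x) - f x) = ∑ j ∈ J', (f (φ' j x) - f x)) :
    flow J φ = flow J' φ' := by
  have : jumpGen J φ = jumpGen J' φ' := by
    ext f x
    rw [jumpGen_apply, jumpGen_apply, h]
  ext1 t
  rw [flow, flow, this]

lemma hasDerivAt_flow (J : Finset ι) (φ : ι → X → X) (t : ℝ) (f : X → ℝ) (x : X) :
    HasDerivAt (fun s => flow J φ s f x) (∑ j ∈ J, (flow J φ t f (φ j x) - flow J φ t f x)) t := by
  have h := hasDerivAt_exp_smul_const' (𝕂 := ℝ) (jumpGen J φ) t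
  have h2 := (((ContinuousLinearMap.proj (R := ℝ) (φ := fun _ : X => ℝ) x).comp
    (ContinuousLinearMap.apply ℝ (X → ℝ) f)).hasFDerivAt.comp_hasDerivAt t h)
  rw [← jumpGen_apply]
  exact h2

/-- Uniformization: the scalar part of the generator commutes with the rest and splits off. What
remains is a power series in the positive operator `sumComp`, so inequalities between semigroups can
be checked term by term on its powers. -/
lemma flow_eq_exp_mul (J : Finset ι) (φ : ι → X → X) (t : ℝ) (f : X → ℝ) (x : X) :
    flow J φ t f x = Real.exp (-(J.card * t)) * exp (t • sumComp J φ) f x := by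
  let _ : NormedAlgebra ℚ ((X → ℝ) →L[ℝ] (X → ℝ)) := NormedAlgebra.restrictScalars ℚ ℝ _
  have h1 : t • jumpGen J φ =
      algebraMap ℝ ((X → ℝ) →L[ℝ] (X → ℝ)) (-(J.card * t)) + t • sumComp J φ := by
    ext f x; simp [jumpGen, Algebra.algebraMap_eq_smul_one]; ring
  rw [flow, h1, exp_add_of_commute (Algebra.commutes _ _), ← algebraMap_exp_comm,
    ← Real.exp_eq_exp_ℝ]
  simp [Algebra.algebraMap_eq_smul_one]

lemma hasSum_exp_sumComp (J : Finset ι) (φ : ι → X → X) (t : ℝ) (f : X → ℝ) (x : X) :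
    HasSum (fun k : ℕ => (k.factorial : ℝ)⁻¹ * (t ^ k * ((sumComp J φ) ^ k) f x))
      (exp (t • sumComp J φ) f x) := by
  have h := exp_series_hasSum_exp' (𝕂 := ℝ) (t • sumComp J φ)
  have h2 := ((ContinuousLinearMap.proj (R := ℝ) (φ := fun _ : X => ℝ) x).comp
    (ContinuousLinearMap.apply ℝ (X → ℝ) f)).hasSum h
  have e : (fun k : ℕ => (k.factorial : ℝ)⁻¹ * (t ^ k * ((sumComp J φ) ^ k) f x)) =
      fun k : ℕ => ((ContinuousLinearMap.proj (R := ℝ) (φ := fun _ : X => ℝ) x).comp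
        (ContinuousLinearMap.apply ℝ (X → ℝ) f)) ((k.factorial : ℝ)⁻¹ • (t • sumComp J φ) ^ k) := by
    funext k; simp [smul_pow]
  rw [e]
  exact h2

/-- Comparison along a relation preserved by simultaneous jumps. -/
lemma flow_le_flow_of_rel {J : Finset ι} {φ : ι → X → X} {ψ : ι → Y → Y} {R : X → Y → Prop}
    (hR : ∀ j ∈ J, ∀ x y, R x y → R (φ j x) (ψ j y)) {f : X → ℝ} {g : Y → ℝ}
    (hfg : ∀ x y, R x y → f x ≤ g y) {t : ℝ} (ht : 0 ≤ t) {x : X} {y : Y} (hxy : R x y) :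
    flow J φ t f x ≤ flow J ψ t g y := by
  have key : ∀ k : ℕ, ∀ x y, R x y → ((sumComp J φ) ^ k) f x ≤ ((sumComp J ψ) ^ k) g y := by
    intro k
    induction k with
    | zero => simpa using hfg
    | succ k ih =>
      intro x y h
      rw [pow_succ', pow_succ']
      exact Finset.sum_le_sum fun j hj => ih _ _ (hR j hj x y h)
  rw [flow_eq_exp_mul, flow_eq_exp_mul]
  refine mul_le_mul_of_nonneg_left ?_ (Real.exp_nonneg _)
  refine hasSum_le (fun k => ?_) (hasSum_exp_sumComp J φ t f x) (hasSum_exp_sumComp J ψ t g y)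
  have := key k x y hxy
  gcongr

lemma flow_mono {J : Finset ι} {φ : ι → X → X} {f g : X → ℝ} (h : ∀ x, f x ≤ g x) {t : ℝ}
    (ht : 0 ≤ t) (x : X) : flow J φ t f x ≤ flow J φ t g x :=
  flow_le_flow_of_rel (R := Eq) (by rintro j - x _ rfl; rfl) (by rintro x _ rfl; exact h x) ht rfl

/-- A function decreasing in mean at rate `c` on a set preserved by the jumps decays
exponentially. -/
lemma flow_le_of_sumComp_le {J : Finset ι} {φ : ι → X → X} {I : X → Prop}
    (hI : ∀ j ∈ J, ∀ x, I x → I (φ j x)) {g : X → ℝ} {c : ℝ} (hc : c ≤ J.card)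
    (h : ∀ x, I x → ∑ j ∈ J, g (φ j x) ≤ (J.card - c) * g x) {t : ℝ} (ht : 0 ≤ t)
    {x : X} (hx : I x) : flow J φ t g x ≤ Real.exp (-(c * t)) * g x := by
  have key : ∀ k : ℕ, ∀ x, I x → ((sumComp J φ) ^ k) g x ≤ (J.card - c) ^ k * g x := by
    intro k
    induction k with
    | zero => simp
    | succ k ih =>
      intro x hx
      rw [pow_succ']
      calc ∑ j ∈ J, ((sumComp J φ) ^ k) g (φ j x) ≤ ∑ j ∈ J, (J.card - c) ^ k * g (φ j x) :=
            Finset.sum_le_sum fun j hj => ih _ (hI j hj x hx)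
        _ = (J.card - c) ^ k * ∑ j ∈ J, g (φ j x) := by rw [Finset.mul_sum]
        _ ≤ (J.card - c) ^ k * ((J.card - c) * g x) := by
            -- This sign is the reason for the hypothesis `c ≤ J.card`.
            have : 0 ≤ (J.card - c : ℝ) := by linarith
            exact mul_le_mul_of_nonneg_left (h x hx) (by positivity)
        _ = _ := by ring
  have hs : HasSum (fun k : ℕ => (k.factorial : ℝ)⁻¹ * (t ^ k * ((J.card - c) ^ k * g x)))
      (Real.exp (t * (J.card - c)) * g x) := by
    have := (exp_series_hasSum_exp' (𝕂 := ℝ) (t * (J.card - c : ℝ))).mul_right (g x)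
    rw [← Real.exp_eq_exp_ℝ] at this
    have e : (fun k : ℕ => (k.factorial : ℝ)⁻¹ * (t ^ k * ((J.card - c : ℝ) ^ k * g x))) =
        fun k : ℕ => (k.factorial : ℝ)⁻¹ • (t * (J.card - c : ℝ)) ^ k * g x := by
      funext k
      rw [smul_eq_mul, mul_pow]; ring
    rwa [e]
  rw [flow_eq_exp_mul]
  calc _ ≤ Real.exp (-(J.card * t)) * (Real.exp (t * (J.card - c)) * g x) := by
        refine mul_le_mul_of_nonneg_left ?_ (Real.exp_nonneg _)
        refine hasSum_le (fun k => ?_) (hasSum_exp_sumComp J φ t g x) hs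
        have := key k x hx
        gcongr
    _ = _ := by rw [← mul_assoc, ← Real.exp_add]; congr 2; ring

lemma flow_const (J : Finset ι) (φ : ι → X → X) (t : ℝ) (c : ℝ) (x : X) :
    flow J φ t (fun _ => c) x = c := by
  have h : ∀ k : ℕ, ((sumComp J φ) ^ k) (fun _ => c) = fun _ => (J.card : ℝ) ^ k * c := by
    intro k
    induction k with
    | zero => simp
    | succ k ih => ext x; rw [pow_succ', mul_apply_eq_comp, ih]; simp; ring
  have hs : HasSum (fun k : ℕ => (k.factorial : ℝ)⁻¹ * (t ^ k * ((J.card : ℝ) ^ k * c)))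
      (Real.exp (t * J.card) * c) := by
    have := (exp_series_hasSum_exp' (𝕂 := ℝ) (t * (J.card : ℝ))).mul_right c
    rw [← Real.exp_eq_exp_ℝ] at this
    have e : (fun k : ℕ => (k.factorial : ℝ)⁻¹ * (t ^ k * ((J.card : ℝ) ^ k * c))) =
        fun k : ℕ => (k.factorial : ℝ)⁻¹ • (t * (J.card : ℝ)) ^ k * c := by
      funext k
      rw [smul_eq_mul, mul_pow]; ring
    rwa [e]
  have := hasSum_exp_sumComp J φ t (fun _ => c) x
  simp only [h] at this
  rw [flow_eq_exp_mul, this.unique hs, ← mul_assoc, ← Real.exp_add]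
  simp [mul_comm]

lemma flow_nonneg {J : Finset ι} {φ : ι → X → X} {f : X → ℝ} (h : ∀ x, 0 ≤ f x) {t : ℝ}
    (ht : 0 ≤ t) (x : X) : 0 ≤ flow J φ t f x := by
  simpa [flow_const] using flow_mono (J := J) (φ := φ) (f := fun _ => 0) h ht x

end Flow

/-! ### Blocks and the toppling maps -/

/-- The open interval `(lo, hi)` consists of sites of `A`, and its end points are not in `A`. -/
structure IsBlock (A : Finset ℤ) (lo hi : ℤ) : Prop where
  lo_notMem : lo ∉ A
  hi_notMem : hi ∉ A
  mem : ∀ x, lo < x → x < hi → x ∈ A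

lemma exists_notMem_add (i : ℤ) (A : Finset ℤ) : {j : ℕ | i + (j : ℤ) ∉ A}.Nonempty := by
  obtain ⟨M, hM⟩ := A.bddAbove
  refine ⟨(M - i).toNat + 1, fun h => ?_⟩
  have := hM h
  push_cast at this
  have := Int.self_le_toNat (M - i)
  omega

lemma exists_notMem_sub (i : ℤ) (A : Finset ℤ) :
    {j : ℕ | 0 < j ∧ i - (j : ℤ) ∉ A}.Nonempty := by
  obtain ⟨M, hM⟩ := A.bddBelow
  refine ⟨(i - M).toNat + 1, by omega, fun h => ?_⟩
  have := hM h
  push_cast at this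
  have := Int.self_le_toNat (i - M)
  omega

lemma isBlock_kMinus_kPlus {A : Finset ℤ} {i : ℤ} (hi : i ∈ A) :
    IsBlock A (i - kMinus i A) (i + kPlus i A) where
  lo_notMem := (Nat.sInf_mem (exists_notMem_sub i A)).2
  hi_notMem := Nat.sInf_mem (exists_notMem_add i A)
  mem x h1 h2 := by
    rcases lt_trichotomy x i with h | h | h
    · by_contra hx
      have : kMinus i A ≤ (i - x).toNat := Nat.sInf_le ⟨by omega, by
        rw [Int.toNat_of_nonneg (by omega)]; simpa using hx⟩
      omega
    · exact h ▸ hi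
    · by_contra hx
      have : kPlus i A ≤ (x - i).toNat := Nat.sInf_le (by
        change i + ((x - i).toNat : ℤ) ∉ A
        rw [Int.toNat_of_nonneg (by omega)]; simpa using hx)
      omega

lemma kMinus_pos (i : ℤ) (A : Finset ℤ) : 0 < kMinus i A :=
  (Nat.sInf_mem (exists_notMem_sub i A)).1

lemma kPlus_pos {A : Finset ℤ} {i : ℤ} (hi : i ∈ A) : 0 < kPlus i A := by
  refine Nat.pos_of_ne_zero fun h => ?_
  have := (isBlock_kMinus_kPlus hi).hi_notMem
  rw [h] at this
  simp [hi] at this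

lemma IsBlock.add_kPlus {A : Finset ℤ} {lo hi i : ℤ} (h : IsBlock A lo hi) (h1 : lo < i)
    (h2 : i < hi) : i + kPlus i A = hi := by
  have hb := isBlock_kMinus_kPlus (h.mem i h1 h2)
  have := kPlus_pos (h.mem i h1 h2)
  rcases lt_trichotomy (i + kPlus i A : ℤ) hi with h' | h' | h'
  · exact absurd (h.mem _ (by omega) h') hb.hi_notMem
  · exact h'
  · exact absurd (hb.mem hi (by have := kMinus_pos i A; omega) h') h.hi_notMem

lemma IsBlock.sub_kMinus {A : Finset ℤ} {lo hi i : ℤ} (h : IsBlock A lo hi) (h1 : lo < i)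
    (h2 : i < hi) : i - kMinus i A = lo := by
  have hb := isBlock_kMinus_kPlus (h.mem i h1 h2)
  have := kMinus_pos i A
  have := kPlus_pos (h.mem i h1 h2)
  rcases lt_trichotomy (i - kMinus i A : ℤ) lo with h' | h' | h'
  · exact absurd (hb.mem lo h' (by omega)) h.lo_notMem
  · exact h'
  · exact absurd (h.mem _ h' (by omega)) hb.lo_notMem

lemma exists_isBlock {A : Finset ℤ} {i : ℤ} (hi : i ∈ A) :
    ∃ lo hi, lo < i ∧ i < hi ∧ IsBlock A lo hi :=
  ⟨_, _, by have := kMinus_pos i A; omega, by have := kPlus_pos hi; omega, isBlock_kMinus_kPlus hi⟩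

lemma IsBlock.topple_eq {A : Finset ℤ} {lo hi i : ℤ} (h : IsBlock A lo hi) (h1 : lo < i)
    (h2 : i < hi) : topple i A = insert hi (insert lo (A.erase (lo + hi - i))) := by
  have e1 := h.add_kPlus h1 h2
  have e2 := h.sub_kMinus h1 h2
  rw [topple, if_pos (h.mem i h1 h2), e2, e1]
  congr 3
  omega

lemma topple_of_notMem {A : Finset ℤ} {i : ℤ} (h : i ∉ A) : topple i A = insert i A := by
  rw [topple, if_neg h]

/-- The configuration obtained by the avalanche of the block of `h` that leaves a hole at `h`. -/
def holeAt (h : ℤ) (A : Finset ℤ) : Finset ℤ :=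
  if h ∈ A then insert (h + (kPlus h A : ℤ)) (insert (h - (kMinus h A : ℤ)) (A.erase h)) else A

lemma IsBlock.holeAt_eq {A : Finset ℤ} {lo hi i : ℤ} (h : IsBlock A lo hi) (h1 : lo < i)
    (h2 : i < hi) : holeAt i A = insert hi (insert lo (A.erase i)) := by
  rw [holeAt, if_pos (h.mem i h1 h2), h.sub_kMinus h1 h2, h.add_kPlus h1 h2]

/-- The block of `h` in `A` lies inside its block in `B`, and both avalanches leave the same hole.
An end point of the smaller block is either an end point of the larger one, hence filled as well, or
is already in `B` and differs from `h`. If `h ∉ A`, the only site that `B` can lose is not in `A`.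
-/
lemma holeAt_mono {A B : Finset ℤ} (hAB : A ⊆ B) (h : ℤ) : holeAt h A ⊆ holeAt h B := by
  by_cases hA : h ∈ A
  · obtain ⟨a, b, h1, h2, hb⟩ := exists_isBlock hA
    obtain ⟨c, d, h3, h4, hb'⟩ := exists_isBlock (hAB hA)
    rw [hb.holeAt_eq h1 h2, hb'.holeAt_eq h3 h4]
    have hca : c ≤ a := by
      by_contra! hlt
      exact hb'.lo_notMem (hAB (hb.mem c hlt (by omega)))
    have hbd : b ≤ d := by
      by_contra! hlt
      exact hb'.hi_notMem (hAB (hb.mem d (by omega) hlt))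
    have ha : a = c ∨ a ∈ B := by
      rcases hca.eq_or_lt with h | h
      · exact .inl h.symm
      · exact .inr (hb'.mem a h (by omega))
    have hb2 : b = d ∨ b ∈ B := by
      rcases hbd.eq_or_lt with h | h
      · exact .inl h
      · exact .inr (hb'.mem b (by omega) h)
    intro x hx
    simp only [Finset.mem_insert, Finset.mem_erase] at hx ⊢
    rcases hx with rfl | rfl | ⟨hx, hx'⟩
    · rcases hb2 with h | h
      · exact .inl h
      · exact .inr (.inr ⟨by omega, h⟩)
    · rcases ha with h | h
      · exact .inr (.inl h)
      · exact .inr (.inr ⟨by omega, h⟩)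
    · exact .inr (.inr ⟨hx, hAB hx'⟩)
  · rw [holeAt, if_neg hA]
    by_cases hB : h ∈ B
    · rw [holeAt, if_pos hB]
      intro x hx
      simp only [Finset.mem_insert, Finset.mem_erase]
      exact .inr (.inr ⟨fun e => hA (e ▸ hx), hAB hx⟩)
    · rwa [holeAt, if_neg hB]

/-- The mirror image of `i` in its block. -/
def mirror (A : Finset ℤ) (i : ℤ) : ℤ := i + kPlus i A - kMinus i A

lemma IsBlock.mirror_eq {A : Finset ℤ} {lo hi i : ℤ} (h : IsBlock A lo hi) (h1 : lo < i)
    (h2 : i < hi) : mirror A i = lo + hi - i := by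
  have e1 := h.add_kPlus h1 h2
  have e2 := h.sub_kMinus h1 h2
  rw [mirror]; omega

lemma mirror_mem {A : Finset ℤ} {i : ℤ} (hi : i ∈ A) : mirror A i ∈ A := by
  obtain ⟨a, b, h1, h2, hb⟩ := exists_isBlock hi
  rw [hb.mirror_eq h1 h2]
  exact hb.mem _ (by omega) (by omega)

lemma mirror_mirror {A : Finset ℤ} {i : ℤ} (hi : i ∈ A) : mirror A (mirror A i) = i := by
  obtain ⟨a, b, h1, h2, hb⟩ := exists_isBlock hi
  rw [hb.mirror_eq h1 h2, hb.mirror_eq (by omega) (by omega)]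
  omega

lemma holeAt_mirror {A : Finset ℤ} {i : ℤ} (hi : i ∈ A) : holeAt (mirror A i) A = topple i A := by
  obtain ⟨a, b, h1, h2, hb⟩ := exists_isBlock hi
  rw [hb.mirror_eq h1 h2, hb.topple_eq h1 h2, hb.holeAt_eq (by omega) (by omega)]

/-- Reflection within blocks is an involution of `A` exchanging the site of the grain with the site
of the hole. -/
lemma sum_holeAt {A : Finset ℤ} (F : Finset ℤ → ℝ) :
    ∑ h ∈ A, F (holeAt h A) = ∑ i ∈ A, F (topple i A) :=
  (Finset.sum_bij' (fun i _ => mirror A i) (fun i _ => mirror A i) (fun _ => mirror_mem)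
    (fun _ => mirror_mem) (fun _ => mirror_mirror) (fun _ => mirror_mirror)
    (fun i hi => by rw [holeAt_mirror hi])).symm

/-! ### The sandpile on a box with sinks at both ends -/

/-- The sites of `[-N,N]`. -/
abbrev box (N : ℕ) : Finset ℤ := Finset.Icc (-(N : ℤ)) N

/-- The configurations with all critical sites in `[-N,N]`. -/
abbrev Box (N : ℕ) : Type := ↥((box N).powerset)

lemma Box.subset {N : ℕ} (A : Box N) : (A : Finset ℤ) ⊆ box N := Finset.mem_powerset.1 A.2

lemma box_mono {m n : ℕ} (h : m ≤ n) : box m ⊆ box n := by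
  intro x; simp only [Finset.mem_Icc]; omega

/-- Discard all critical sites outside the box. -/
def trunc (N : ℕ) (A : Finset ℤ) : Box N :=
  ⟨A ∩ box N, Finset.mem_powerset.2 Finset.inter_subset_right⟩

lemma trunc_of_subset {N : ℕ} {A : Finset ℤ} (h : A ⊆ box N) :
    trunc N A = ⟨A, Finset.mem_powerset.2 h⟩ := by
  ext1; exact Finset.inter_eq_left.2 h

@[simp] lemma trunc_coe {N : ℕ} (A : Box N) : trunc N A = A := trunc_of_subset A.subset

@[simp] lemma coe_trunc (N : ℕ) (A : Finset ℤ) : (trunc N A : Finset ℤ) = A ∩ box N := rfl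

/-- Add a grain at `i` in the box; births are allowed in `[-n,n]` only. -/
def addGrain (n N : ℕ) (i : ℤ) (A : Box N) : Box N :=
  if i ∈ activeSites n A then trunc N (topple i A) else A

/-- The jumps with a prescribed hole (`inl`) and the births in `[-n,n]` (`inr`). -/
def clockMap (n N : ℕ) : ℤ ⊕ ℤ → Box N → Box N
  | .inl h, A => trunc N (holeAt h A)
  | .inr i, A => if i ∈ box n then trunc N (insert i (A : Finset ℤ)) else A

/-- The monotone coupling. It requires separate clocks for births and for holes: with one clock per
grain position the order is lost, since the hole in the larger configuration may be at a critical
site of the smaller one. -/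
lemma clockMap_mono {n n' N N' : ℕ} (hn : n ≤ n') (hN : N ≤ N') (j : ℤ ⊕ ℤ) {A : Box N}
    {B : Box N'} (h : (A : Finset ℤ) ⊆ B) :
    (clockMap n N j A : Finset ℤ) ⊆ clockMap n' N' j B := by
  cases j with
  | inl x => exact Finset.inter_subset_inter (holeAt_mono h x) (box_mono hN)
  | inr x =>
    simp only [clockMap]
    split_ifs with h1 h2 h2
    · exact Finset.inter_subset_inter (Finset.insert_subset_insert _ h) (box_mono hN)
    · exact absurd (box_mono hn h1) h2
    · refine h.trans fun y hy => ?_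
      simp [hy, Finset.mem_Icc.1 (B.subset hy)]
    · exact h

/-- A hole clock outside `A`, or a birth clock inside `A` or outside `[-n,n]`, changes nothing; the
remaining hole clocks are the avalanches, reindexed by reflection. The freedom in `M` allows boxes
of different sizes to share one set of clocks. -/
lemma sum_clockMap {n N M : ℕ} (hn : n ≤ N) (hM : N ≤ M) (f : Box N → ℝ) (A : Box N) :
    ∑ j ∈ (box M).disjSum (box M), (f (clockMap n N j A) - f A) =
      ∑ i ∈ box N, (f (addGrain n N i A) - f A) := by
  have hA := A.subset
  have hAM := hA.trans (box_mono hM)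
  rw [Finset.sum_disjSum]
  have h1 : ∑ h ∈ box M, (f (clockMap n N (.inl h) A) - f A) =
      ∑ h ∈ (A : Finset ℤ), (f (trunc N (holeAt h A)) - f A) := by
    refine (Finset.sum_subset hAM fun x _ hx => ?_).symm
    simp [clockMap, holeAt, hx]
  have h2 : ∑ i ∈ box M, (f (clockMap n N (.inr i) A) - f A) =
      ∑ i ∈ box n \ A, (f (trunc N (topple i A)) - f A) := by
    rw [← Finset.sum_subset (Finset.sdiff_subset.trans (box_mono (hn.trans hM)))]
    · refine Finset.sum_congr rfl fun x hx => ?_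
      rw [Finset.mem_sdiff] at hx
      simp only [clockMap]
      rw [topple_of_notMem hx.2, if_pos hx.1]
    · intro x _ hx
      simp only [clockMap]
      split_ifs with h
      · have hxA : x ∈ (A : Finset ℤ) := by
          by_contra h'; exact hx (Finset.mem_sdiff.2 ⟨h, h'⟩)
        rw [Finset.insert_eq_of_mem hxA]; simp
      · simp
  have h3 : ∑ i ∈ box N, (f (addGrain n N i A) - f A) =
      ∑ i ∈ activeSites n A, (f (trunc N (topple i A)) - f A) := by
    rw [← Finset.sum_subset (s₁ := activeSites n A)]
    · exact Finset.sum_congr rfl fun x hx => by rw [addGrain, if_pos hx]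
    · exact Finset.union_subset hA (box_mono hn)
    · intro x _ hx; rw [addGrain, if_neg hx, sub_self]
  rw [h1, h2, h3, activeSites, ← Finset.union_sdiff_self_eq_union,
    Finset.sum_union Finset.disjoint_sdiff, Finset.sum_sub_distrib, Finset.sum_sub_distrib (s := A.1),
    sum_holeAt (fun B => f (trunc N B))]

/-- The semigroup of the sandpile on the box `[-N,N]` with births in `[-n,n]`. -/
def boxFlow (n N : ℕ) (t : ℝ) : (Box N → ℝ) →L[ℝ] (Box N → ℝ) := flow (box N) (addGrain n N) t

lemma boxFlow_eq_flow_clockMap {n N M : ℕ} (hn : n ≤ N) (hM : N ≤ M) :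
    boxFlow n N = flow ((box M).disjSum (box M)) (clockMap n N) :=
  (flow_congr fun f A => sum_clockMap hn hM f A).symm

lemma boxFlow_le_boxFlow {n n' N N' : ℕ} (hn : n ≤ n') (hnN : n ≤ N) (hnN' : n' ≤ N')
    (hN : N ≤ N') {f : Box N → ℝ} {g : Box N' → ℝ}
    (hfg : ∀ (A : Box N) (B : Box N'), (A : Finset ℤ) ⊆ B → f A ≤ g B) {t : ℝ} (ht : 0 ≤ t)
    {A : Box N} {B : Box N'} (hAB : (A : Finset ℤ) ⊆ B) :
    boxFlow n N t f A ≤ boxFlow n' N' t g B := by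
  rw [boxFlow_eq_flow_clockMap hnN hN, boxFlow_eq_flow_clockMap hnN' le_rfl]
  exact flow_le_flow_of_rel (R := fun (A : Box N) (B : Box N') => (A : Finset ℤ) ⊆ B)
    (fun j _ A B h => clockMap_mono hn hN j h) hfg ht hAB

/-! ### The minimal chain is the limit of the box sandpiles -/

lemma card_topple_le (i : ℤ) (A : Finset ℤ) : (topple i A).card ≤ A.card + 1 := by
  by_cases hi : i ∈ A
  · rw [← holeAt_mirror hi, holeAt, if_pos (mirror_mem hi)]
    refine (Finset.card_insert_le _ _).trans ?_
    have h1 := Finset.card_insert_le (mirror A i - (kMinus (mirror A i) A : ℤ)) (A.erase (mirror A i))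
    have h2 := Finset.card_erase_add_one (mirror_mem hi)
    omega
  · rw [topple_of_notMem hi]; exact Finset.card_insert_le _ _

lemma card_box (n : ℕ) : (box n).card = 2 * n + 1 := by
  rw [Int.card_Icc]; omega

lemma rate_pos (n : ℕ) (A : Finset ℤ) : 0 < rate n A := by
  rw [rate, Nat.cast_pos]
  exact Finset.card_pos.2 ⟨0, by simp [activeSites]⟩

lemma rate_le (n : ℕ) (A : Finset ℤ) : rate n A ≤ A.card + (2 * n + 1) := by
  rw [rate]
  exact_mod_cast (Finset.card_union_le _ _).trans_eq (by rw [card_box])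

lemma measurable_transIter (n : ℕ) (B : Finset ℤ) (m : ℕ) (A : Finset ℤ) :
    Measurable fun t => transIter n B m t A := by
  induction m generalizing A with
  | zero =>
    simp only [transIter]
    split_ifs <;> fun_prop
  | succ m ih =>
    simp only [transIter]
    refine Measurable.add (by split_ifs <;> fun_prop) ?_
    have h : ∀ t : ℝ, ∫⁻ s in Set.Ioc 0 t, ENNReal.ofReal (Real.exp (-(rate n A * s))) *
          ∑ i ∈ activeSites n A, transIter n B m (t - s) (topple i A) =
        ∫⁻ s, {p : ℝ × ℝ | 0 < p.2 ∧ p.2 ≤ p.1}.indicator (fun p =>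
          ENNReal.ofReal (Real.exp (-(rate n A * p.2))) *
          ∑ i ∈ activeSites n A, transIter n B m (p.1 - p.2) (topple i A)) (t, s) := by
      intro t
      rw [← lintegral_indicator measurableSet_Ioc]
      rfl
    simp only [h]
    refine Measurable.lintegral_prod_right' (Measurable.indicator ?_ ?_)
    · refine Measurable.mul (by fun_prop) (Finset.measurable_sum _ fun i _ => ?_)
      exact (ih (topple i A)).comp (measurable_fst.sub measurable_snd)
    · exact (measurableSet_lt measurable_const measurable_snd).inter
        (measurableSet_le measurable_snd measurable_fst)

lemma tsum_transIter_succ (n m : ℕ) (t : ℝ) (A : Finset ℤ) :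
    ∑' B, transIter n B (m + 1) t A = ENNReal.ofReal (Real.exp (-(rate n A * t))) +
      ∫⁻ s in Set.Ioc 0 t, ENNReal.ofReal (Real.exp (-(rate n A * s))) *
        ∑ i ∈ activeSites n A, ∑' B, transIter n B m (t - s) (topple i A) := by
  have hm : ∀ B, Measurable fun s => ENNReal.ofReal (Real.exp (-(rate n A * s))) *
      ∑ i ∈ activeSites n A, transIter n B m (t - s) (topple i A) := fun B =>
    Measurable.mul (by fun_prop) (Finset.measurable_sum _ fun i _ =>
      (measurable_transIter n B m (topple i A)).comp (measurable_const.sub measurable_id))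
  simp only [transIter]
  rw [ENNReal.tsum_add, tsum_ite_eq', ← lintegral_tsum fun B => (hm B).aemeasurable]
  congr 1
  refine lintegral_congr fun s => ?_
  rw [ENNReal.tsum_mul_left, Summable.tsum_finsetSum fun _ _ => ENNReal.summable]

lemma lintegral_exp_neg {a t : ℝ} (ha : 0 < a) (ht : 0 ≤ t) :
    ∫⁻ s in Set.Ioc 0 t, ENNReal.ofReal (Real.exp (-(a * s))) =
      ENNReal.ofReal ((1 - Real.exp (-(a * t))) / a) := by
  rw [← ofReal_integral_eq_lintegral_ofReal, ← intervalIntegral.integral_of_le ht]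
  · congr 1
    have hd : ∀ s ∈ Set.uIcc 0 t,
        HasDerivAt (fun s => -Real.exp (-(a * s)) / a) (Real.exp (-(a * s))) s := by
      intro s _
      have h1 : HasDerivAt (fun s => -(a * s)) (-(a * 1)) s := ((hasDerivAt_id s).const_mul a).neg
      have h2 := (h1.exp.neg).div_const a
      refine h2.congr_deriv ?_
      field_simp
    rw [intervalIntegral.integral_eq_sub_of_hasDerivAt hd
      (Continuous.intervalIntegrable (by fun_prop) _ _)]
    simp; ring
  · exact (Continuous.integrableOn_Icc (by fun_prop)).mono_set Set.Ioc_subset_Icc_self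
  · exact Eventually.of_forall fun _ => Real.exp_nonneg _

/-- The chain makes more than `m` jumps before time `t` with probability at most
`e ^ t * K / (m + K)`. -/
lemma one_le_tsum_transIter (n m : ℕ) {t : ℝ} (ht : 0 ≤ t) (A : Finset ℤ) :
    1 ≤ ∑' B, transIter n B m t A +
      ENNReal.ofReal (Real.exp t * ((A.card + (2 * n + 1)) / (m + (A.card + (2 * n + 1))))) := by
  induction m generalizing t A with
  | zero =>
    refine le_add_left ?_
    rw [ENNReal.one_le_ofReal, Nat.cast_zero, zero_add, div_self (by positivity), mul_one]
    exact Real.one_le_exp ht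
  | succ m ih =>
    set r := rate n A with hr
    have hr0 : 0 < r := rate_pos n A
    set K : ℝ := A.card + (2 * n + 1) with hK
    have hK0 : 0 < K := by positivity
    -- The induction hypothesis after the first jump: the number of critical sites, and hence `K`,
    -- has grown by at most one.
    set w : ℝ := (K + 1) / (m + (K + 1)) with hw
    have hw0 : 0 ≤ w := by positivity
    have hrK : r ≤ K := rate_le n A
    have hone : 1 = ENNReal.ofReal (Real.exp (-(r * t))) +
        ∫⁻ s in Set.Ioc 0 t, ENNReal.ofReal (Real.exp (-(r * s))) * ENNReal.ofReal r := by
      rw [lintegral_mul_const _ (by fun_prop), lintegral_exp_neg hr0 ht,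
        ← ENNReal.ofReal_mul' hr0.le, ← ENNReal.ofReal_add (Real.exp_nonneg _), div_mul_cancel₀ _ hr0.ne']
      · simp
      · rw [div_mul_cancel₀ _ hr0.ne', sub_nonneg, Real.exp_le_one_iff]
        simp; positivity
    have hsum : ∀ s ∈ Set.Ioc 0 t, ENNReal.ofReal r ≤
        ∑ i ∈ activeSites n A, ∑' B, transIter n B m (t - s) (topple i A) +
          ENNReal.ofReal (r * (Real.exp (t - s) * w)) := by
      intro s hs
      have hcard : ENNReal.ofReal r = ∑ i ∈ activeSites n A, (1 : ℝ≥0∞) := by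
        rw [hr, rate]; simp
      have hcard2 : ENNReal.ofReal (r * (Real.exp (t - s) * w)) =
          ∑ i ∈ activeSites n A, ENNReal.ofReal (Real.exp (t - s) * w) := by
        rw [ENNReal.ofReal_mul hr0.le, hcard, Finset.sum_mul]; simp
      rw [hcard2, ← Finset.sum_add_distrib, hcard]
      refine Finset.sum_le_sum fun i _ => (ih (sub_nonneg.2 hs.2) (topple i A)).trans ?_
      gcongr
      have hc : ((topple i A).card : ℝ) ≤ A.card + 1 := by exact_mod_cast card_topple_le i A
      have hc0 : (0 : ℝ) ≤ (topple i A).card := Nat.cast_nonneg _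
      have hm : (0 : ℝ) ≤ m := Nat.cast_nonneg _
      generalize ((topple i A).card : ℝ) = c at hc hc0
      rw [hw, div_le_div_iff₀ (by positivity) (by linarith)]
      nlinarith
    have hint : ∫⁻ s in Set.Ioc 0 t, ENNReal.ofReal (Real.exp (-(r * s))) *
        ENNReal.ofReal (r * (Real.exp (t - s) * w)) ≤
        ENNReal.ofReal (Real.exp t * (K / ((m + 1 : ℕ) + K))) := by
      have h1 : ∀ s, ENNReal.ofReal (Real.exp (-(r * s))) *
          ENNReal.ofReal (r * (Real.exp (t - s) * w)) =
          ENNReal.ofReal (Real.exp (-((r + 1) * s))) * ENNReal.ofReal (r * (Real.exp t * w)) := by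
        intro s
        rw [← ENNReal.ofReal_mul (Real.exp_nonneg _), ← ENNReal.ofReal_mul (Real.exp_nonneg _)]
        congr 1
        have : Real.exp (-((r + 1) * s)) * Real.exp t =
            Real.exp (-(r * s)) * Real.exp (t - s) := by
          rw [← Real.exp_add, ← Real.exp_add]; congr 1; ring
        linear_combination (-(r * w)) * this
      simp only [h1]
      rw [lintegral_mul_const _ (by fun_prop), lintegral_exp_neg (by linarith) ht,
        ← ENNReal.ofReal_mul' (by positivity)]
      apply ENNReal.ofReal_le_ofReal
      -- The factor `exp (t - s)` turns the rate `r` into `r + 1`, so the first jump contributes `r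
      -- / (r + 1) ≤ K / (K + 1)`; this cancels the numerator of `w` and leaves `K / (m + 1 + K)`.
      have h2 : (1 - Real.exp (-((r + 1) * t))) / (r + 1) ≤ 1 / (r + 1) := by
        gcongr; linarith [Real.exp_nonneg (-((r + 1) * t))]
      calc _ ≤ 1 / (r + 1) * (r * (Real.exp t * w)) := by gcongr
        _ = Real.exp t * (r / (r + 1) * w) := by ring
        _ ≤ Real.exp t * (K / (K + 1) * w) := by
            gcongr ?_ * (?_ * _)
            rw [div_le_div_iff₀ (by linarith) (by linarith)]; nlinarith
        _ = _ := by rw [hw]; push_cast; field_simp; ring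
    rw [tsum_transIter_succ, add_assoc]
    conv_lhs => rw [hone]
    gcongr
    refine le_trans ?_ (add_le_add_right hint _)
    rw [← lintegral_add_right _ (by fun_prop)]
    refine setLIntegral_mono' measurableSet_Ioc fun s hs => ?_
    rw [← mul_add]
    gcongr
    exact hsum s hs

lemma sum_addGrain {n N : ℕ} (hn : n ≤ N) (f : Box N → ℝ) (A : Box N) :
    ∑ i ∈ box N, (f (addGrain n N i A) - f A) =
      ∑ i ∈ activeSites n A, f (trunc N (topple i A)) - rate n A * f A := by
  rw [← Finset.sum_subset (s₁ := activeSites n A)]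
  · rw [Finset.sum_congr rfl fun x hx => by rw [addGrain, if_pos hx], Finset.sum_sub_distrib]
    simp [rate]
  · exact Finset.union_subset A.subset (box_mono hn)
  · intro x _ hx; rw [addGrain, if_neg hx, sub_self]

lemma continuous_boxFlow (n N : ℕ) (f : Box N → ℝ) (A : Box N) :
    Continuous fun t => boxFlow n N t f A :=
  continuous_iff_continuousAt.2 fun t => (hasDerivAt_flow _ _ t f A).continuousAt

/-- The first jump decomposition of the box semigroup. -/
lemma boxFlow_eq_integral {n N : ℕ} (hn : n ≤ N) (f : Box N → ℝ) (t : ℝ) (A : Box N) :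
    boxFlow n N t f A = Real.exp (-(rate n A * t)) * f A +
      ∫ s in (0 : ℝ)..t, Real.exp (-(rate n A * s)) *
        ∑ i ∈ activeSites n A, boxFlow n N (t - s) f (trunc N (topple i A)) := by
  have hd : ∀ s ∈ Set.uIcc 0 t,
      HasDerivAt (fun s => -(Real.exp (-(rate n A * s)) * boxFlow n N (t - s) f A))
        (Real.exp (-(rate n A * s)) *
          ∑ i ∈ activeSites n A, boxFlow n N (t - s) f (trunc N (topple i A))) s := by
    intro s _
    have h1 : HasDerivAt (fun s => -(rate n A * s)) (-(rate n A * 1)) s :=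
      ((hasDerivAt_id s).const_mul _).neg
    have h2 : HasDerivAt (fun s => boxFlow n N (t - s) f A) _ s :=
      (hasDerivAt_flow (box N) (addGrain n N) (t - s) f A).comp_const_sub t s
    have h3 := (h1.exp.mul h2).neg
    refine h3.congr_deriv ?_
    have := sum_addGrain hn (boxFlow n N (t - s) f) A
    simp only [boxFlow] at this ⊢
    rw [this]; ring
  rw [intervalIntegral.integral_eq_sub_of_hasDerivAt hd]
  · simp [boxFlow, flow_zero]
  · refine Continuous.intervalIntegrable ?_ _ _
    refine Continuous.mul (by fun_prop) (continuous_finsetSum _ fun i _ => ?_)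
    exact (continuous_boxFlow n N f _).comp (continuous_const.sub continuous_id)

lemma ofReal_boxFlow {n N : ℕ} (hn : n ≤ N) {f : Box N → ℝ} (hf : ∀ A, 0 ≤ f A) {t : ℝ}
    (ht : 0 ≤ t) (A : Box N) :
    ENNReal.ofReal (boxFlow n N t f A) = ENNReal.ofReal (Real.exp (-(rate n A * t)) * f A) +
      ∫⁻ s in Set.Ioc 0 t, ENNReal.ofReal (Real.exp (-(rate n A * s))) *
        ∑ i ∈ activeSites n A, ENNReal.ofReal (boxFlow n N (t - s) f (trunc N (topple i A))) := by
  have hnn : ∀ s ∈ Set.Ioc 0 t, ∀ B, 0 ≤ boxFlow n N (t - s) f B := fun s hs B =>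
    flow_nonneg hf (sub_nonneg.2 hs.2) B
  have hnn' : ∀ s ∈ Set.Ioc 0 t, 0 ≤ Real.exp (-(rate n A * s)) *
        ∑ i ∈ activeSites n A, boxFlow n N (t - s) f (trunc N (topple i A)) := fun s hs =>
    mul_nonneg (Real.exp_nonneg _) (Finset.sum_nonneg fun i _ => hnn s hs _)
  rw [boxFlow_eq_integral hn, intervalIntegral.integral_of_le ht, ENNReal.ofReal_add
    (mul_nonneg (Real.exp_nonneg _) (hf A)) (setIntegral_nonneg measurableSet_Ioc hnn')]
  congr 1
  rw [ofReal_integral_eq_lintegral_ofReal]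
  · refine setLIntegral_congr_fun measurableSet_Ioc fun s hs => ?_
    rw [ENNReal.ofReal_mul (Real.exp_nonneg _), ENNReal.ofReal_sum_of_nonneg fun i _ => hnn s hs _]
  · refine (Continuous.integrableOn_Icc ?_).mono_set Set.Ioc_subset_Icc_self
    refine Continuous.mul (by fun_prop) (continuous_finsetSum _ fun i _ => ?_)
    exact (continuous_boxFlow n N f _).comp (continuous_const.sub continuous_id)
  · exact (ae_restrict_iff' measurableSet_Ioc).2 (Eventually.of_forall hnn')

lemma topple_subset_box {i : ℤ} {A : Finset ℤ} {k : ℕ} (hA : A ⊆ box k) (hi : i ∈ box k) :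
    topple i A ⊆ box (k + 1) := by
  have hk : box k ⊆ box (k + 1) := box_mono (Nat.le_succ k)
  by_cases h : i ∈ A
  · obtain ⟨a, b, h1, h2, hb⟩ := exists_isBlock h
    rw [hb.topple_eq h1 h2]
    have ha := Finset.mem_Icc.1 (hA (hb.mem (a + 1) (by omega) (by omega)))
    have hb := Finset.mem_Icc.1 (hA (hb.mem (b - 1) (by omega) (by omega)))
    refine Finset.insert_subset ?_ (Finset.insert_subset ?_
      ((Finset.erase_subset _ _).trans (hA.trans hk)))
    · rw [Finset.mem_Icc]; push_cast; omega
    · rw [Finset.mem_Icc]; push_cast; omega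
  · rw [topple_of_notMem h]
    exact Finset.insert_subset (hk hi) (hA.trans hk)

/-- Each jump enlarges the box containing the configuration by at most one, so `m` jumps from `box
k` stay inside `box N` and never feel the sinks. Up to there both sides obey the same first-jump
recursion. -/
lemma transIter_le_boxFlow {n N : ℕ} (B : Finset ℤ) (m : ℕ) {k : ℕ} {A : Finset ℤ} {t : ℝ}
    (ht : 0 ≤ t) (hn : n ≤ k) (hA : A ⊆ box k) (hN : k + m ≤ N) :
    transIter n B m t A ≤
      ENNReal.ofReal (boxFlow n N t (fun C => if (C : Finset ℤ) = B then 1 else 0) (trunc N A)) := by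
  have hAN : (trunc N A : Finset ℤ) = A := by
    rw [trunc_of_subset (hA.trans (box_mono (by omega)))]
  have hf : ∀ C : Box N, (0 : ℝ) ≤ if (C : Finset ℤ) = B then 1 else 0 := fun C => by
    split_ifs <;> simp
  induction m generalizing k A t with
  | zero =>
    rw [ofReal_boxFlow (by omega) hf ht, hAN, transIter]
    refine le_add_right (le_of_eq ?_)
    split_ifs <;> simp
  | succ m ih =>
    rw [ofReal_boxFlow (by omega) hf ht, hAN, transIter]
    gcongr ?_ + ?_
    · refine le_of_eq ?_
      split_ifs <;> simp
    · refine setLIntegral_mono' measurableSet_Ioc fun s hs => ?_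
      gcongr with i hi
      have hi' : i ∈ box k := (Finset.union_subset hA (box_mono hn)) hi
      have hsub := topple_subset_box hA hi'
      refine ih (sub_nonneg.2 hs.2) (hn.trans (Nat.le_succ k)) hsub (by omega) ?_
      rw [trunc_of_subset (hsub.trans (box_mono (by omega)))]

lemma boxFlow_const (n N : ℕ) (t c : ℝ) (A : Box N) : boxFlow n N t (fun _ => c) A = c :=
  flow_const _ _ _ _ _

lemma boxFlow_nonneg {n N : ℕ} {t : ℝ} (ht : 0 ≤ t) {f : Box N → ℝ} (hf : ∀ A, 0 ≤ f A)
    (A : Box N) : 0 ≤ boxFlow n N t f A := flow_nonneg hf ht A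

/-! ### Fatou bounds and conservation of mass -/

lemma transProb_le_liminf (n : ℕ) (t : ℝ≥0) (A B : Finset ℤ) :
    transProb n t A B ≤ liminf (fun N => ENNReal.ofReal
      (boxFlow n N t (fun C => if (C : Finset ℤ) = B then 1 else 0) (trunc N A))) atTop := by
  obtain ⟨k, hk⟩ : ∃ k, A ⊆ box k := by
    obtain ⟨a, ha⟩ := A.bddAbove
    obtain ⟨b, hb⟩ := A.bddBelow
    refine ⟨a.toNat + (-b).toNat, fun x hx => ?_⟩
    have h1 := ha hx
    have h2 := hb hx
    rw [Finset.mem_Icc]; omega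
  refine iSup_le fun m => le_liminf_of_le (by isBoundedDefault) ?_
  filter_upwards [eventually_ge_atTop (max n k + m)] with N hN
  exact transIter_le_boxFlow B m t.2 (le_max_left n k)
    (hk.trans (box_mono (le_max_right n k))) hN

lemma boxFlow_eq_sum (n N : ℕ) (t : ℝ) (f : Box N → ℝ) (A : Box N) :
    boxFlow n N t f A =
      ∑ C : Box N, f C * boxFlow n N t (fun D => if D = C then 1 else 0) A := by
  have hf : f = ∑ C : Box N, f C • (fun D : Box N => if D = C then (1 : ℝ) else 0) := by
    ext D; simp
  conv_lhs => rw [hf]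
  simp [map_sum, Finset.sum_apply]

lemma tsum_ofReal_boxFlow_mul (n N : ℕ) (t : ℝ≥0) {f : Finset ℤ → ℝ} (hf : ∀ B, 0 ≤ f B)
    (A : Box N) :
    ∑' B, ENNReal.ofReal (boxFlow n N t (fun C => if (C : Finset ℤ) = B then 1 else 0) A) *
      ENNReal.ofReal (f B) = ENNReal.ofReal (boxFlow n N t (fun C => f C) A) := by
  have hnn : ∀ B : Finset ℤ,
      0 ≤ boxFlow n N t (fun C => if (C : Finset ℤ) = B then (1 : ℝ) else 0) A := fun B =>
    flow_nonneg (fun C => by split_ifs <;> simp) t.2 A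
  rw [tsum_eq_sum (s := (box N).powerset), boxFlow_eq_sum,
    ← Finset.sum_coe_sort, ENNReal.ofReal_sum_of_nonneg]
  · refine Finset.sum_congr rfl fun C _ => ?_
    rw [← ENNReal.ofReal_mul (hnn _), mul_comm]
    simp only [Subtype.ext_iff]
  · intro C _
    refine mul_nonneg (hf _) ?_
    have := hnn C
    simpa only [Subtype.ext_iff] using this
  · intro B hB
    have : (fun C : Box N => if (C : Finset ℤ) = B then (1 : ℝ) else 0) = 0 := by
      ext C
      have hC : (C : Finset ℤ) ≠ B := fun h => hB (h ▸ C.2)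
      simp [hC]
    rw [this, map_zero]; simp

/-- Fatou's lemma for the counting measure on target states. -/
lemma tsum_transProb_mul_le_liminf (n : ℕ) (t : ℝ≥0) {f : Finset ℤ → ℝ} (hf : ∀ B, 0 ≤ f B)
    (A : Finset ℤ) :
    ∑' B, transProb n t A B * ENNReal.ofReal (f B) ≤
      liminf (fun N => ENNReal.ofReal (boxFlow n N t (fun C => f C) (trunc N A))) atTop := by
  simp only [← tsum_ofReal_boxFlow_mul n _ t hf]
  let _ : MeasurableSpace (Finset ℤ) := ⊤
  simp only [← lintegral_count]
  refine le_trans (lintegral_mono fun B => ?_) (lintegral_liminf_le fun N => measurable_from_top)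
  refine (mul_le_mul_left (transProb_le_liminf n t A B) _).trans ?_
  conv_lhs => rw [← liminf_const (f := atTop (α := ℕ)) (ENNReal.ofReal (f B))]
  exact ENNReal.le_liminf_mul

/-- Non-explosion: Fatou gives `≤`, and the bound on the probability of more than `m` jumps gives
`≥` as `m` tends to infinity. -/
lemma tsum_transProb (n : ℕ) (t : ℝ≥0) (A : Finset ℤ) : ∑' B, transProb n t A B = 1 := by
  refine le_antisymm ?_ ?_
  · have := tsum_transProb_mul_le_liminf n t (f := fun _ => 1) (fun _ => zero_le_one) A
    simpa [boxFlow_const] using this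
  · set K : ℝ := A.card + (2 * n + 1) with hK
    have hlim : Tendsto (fun m : ℕ => ∑' B, transProb n t A B +
        ENNReal.ofReal (Real.exp t * (K / (m + K)))) atTop
        (𝓝 (∑' B, transProb n t A B + ENNReal.ofReal (Real.exp t * 0))) := by
      refine tendsto_const_nhds.add (ENNReal.tendsto_ofReal (tendsto_const_nhds.mul ?_))
      exact tendsto_const_nhds.div_atTop
        (tendsto_atTop_add_const_right _ _ tendsto_natCast_atTop_atTop)
    rw [mul_zero, ENNReal.ofReal_zero, add_zero] at hlim
    refine ge_of_tendsto' hlim fun m => (one_le_tsum_transIter n m t.2 A).trans ?_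
    refine add_le_add_left (ENNReal.tsum_le_tsum fun B => ?_) _
    exact le_iSup (fun m => transIter n B m t A) m

/-- The chain on finite sets is the limit of the sandpiles on growing boxes. -/
lemma tendsto_boxFlow (n : ℕ) (t : ℝ≥0) {f : Finset ℤ → ℝ} {C : ℝ} (hf : ∀ B, |f B| ≤ C)
    (A : Finset ℤ) :
    Tendsto (fun N => boxFlow n N t (fun B => f B) (trunc N A)) atTop
      (𝓝 (∑' B, (transProb n t A B).toReal * f B)) := by
  have hsum : Summable fun B => (transProb n t A B).toReal :=
    ENNReal.summable_toReal (by simp [tsum_transProb])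
  have hone : ∑' B, (transProb n t A B).toReal = 1 := by
    rw [← ENNReal.tsum_toReal_eq, tsum_transProb, ENNReal.toReal_one]
    exact fun B => ne_top_of_le_ne_top (by simp [tsum_transProb]) (ENNReal.le_tsum (f := transProb n t A) B)
  have hs : ∀ {g : Finset ℤ → ℝ}, (∀ B, |g B| ≤ C) →
      Summable fun B => (transProb n t A B).toReal * g B := fun {g} hg =>
    Summable.of_norm_bounded (hsum.mul_right C) fun B => by
      rw [norm_mul, Real.norm_of_nonneg ENNReal.toReal_nonneg]
      exact mul_le_mul_of_nonneg_left (hg B) ENNReal.toReal_nonneg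
  -- The lower half of the convergence, from Fatou applied to `g + C ≥ 0`; the constant can be
  -- subtracted again because both sides have total mass one. Using it for `f` and for `-f` yields
  -- the limit.
  have lower : ∀ g : Finset ℤ → ℝ, (∀ B, |g B| ≤ C) → ∀ y < ∑' B, (transProb n t A B).toReal * g B,
      ∀ᶠ N in atTop, y < boxFlow n N t (fun B => g B) (trunc N A) := by
    intro g hg y hy
    have hg0 : ∀ B, 0 ≤ g B + C := fun B => by have := neg_le_of_abs_le (hg B); linarith
    have h1 : ENNReal.ofReal (∑' B, (transProb n t A B).toReal * (g B + C)) ≤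
        ∑' B, transProb n t A B * ENNReal.ofReal (g B + C) := by
      rw [ENNReal.ofReal_tsum_of_nonneg fun B => mul_nonneg ENNReal.toReal_nonneg (hg0 B)]
      · refine ENNReal.tsum_le_tsum fun B => ?_
        rw [ENNReal.ofReal_mul ENNReal.toReal_nonneg]
        gcongr
        exact ENNReal.ofReal_toReal_le
      · simp only [mul_add]
        exact (hs hg).add (hsum.mul_right C)
    have h2 : ∑' B, (transProb n t A B).toReal * (g B + C) =
        ∑' B, (transProb n t A B).toReal * g B + C := by
      simp only [mul_add]
      rw [(hs hg).tsum_add (hsum.mul_right C), tsum_mul_right, hone, one_mul]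
    have h3 : ∀ N, boxFlow n N t (fun B => g B + C) (trunc N A) =
        boxFlow n N t (fun B => g B) (trunc N A) + C := by
      intro N
      have : (fun B : Box N => g B + C) = (fun B : Box N => g B) + fun _ => C := rfl
      rw [this, map_add, Pi.add_apply]
      congr 1
      exact boxFlow_const _ _ _ _ _
    by_cases hy0 : y + C < 0
    · refine Eventually.of_forall fun N => ?_
      have : 0 ≤ boxFlow n N t (fun B => g B + C) (trunc N A) :=
        boxFlow_nonneg t.2 (fun B => hg0 B) _
      rw [h3] at this; linarith
    · push Not at hy0
      have h4 : ENNReal.ofReal (y + C) < liminf (fun N => ENNReal.ofReal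
          (boxFlow n N t (fun B => g B + C) (trunc N A))) atTop := by
        refine lt_of_lt_of_le ?_ (h1.trans (tsum_transProb_mul_le_liminf n t hg0 A))
        rw [ENNReal.ofReal_lt_ofReal_iff_of_nonneg hy0, h2]; linarith
      filter_upwards [eventually_lt_of_lt_liminf h4] with N hN
      rw [ENNReal.ofReal_lt_ofReal_iff_of_nonneg hy0, h3] at hN
      linarith
  refine tendsto_order.2 ⟨lower f hf, fun y hy => ?_⟩
  have hneg : ∑' B, (transProb n t A B).toReal * (-f B) =
      -∑' B, (transProb n t A B).toReal * f B := by simp [tsum_neg]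
  filter_upwards [lower (fun B => -f B) (by simpa using hf) (-y) (by rw [hneg]; linarith)] with N hN
  have : (fun B : Box N => -f B) = -fun B : Box N => f B := rfl
  rw [this, map_neg, Pi.neg_apply] at hN
  linarith

/-! ### Monotone cylinder events -/

/-- The event that all coordinates in `F` have height two. -/
def upSet {Z : Type*} (F : Finset Z) : Set (Z → Height) := {ω | ∀ z ∈ F, (ω z : ℕ) = 2}

lemma height_eq_one_or_two (a : Height) : (a : ℕ) = 1 ∨ (a : ℕ) = 2 := a.2

lemma isClopen_upSet {Z : Type*} (F : Finset Z) : IsClopen (upSet F) := by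
  have h : upSet F = ⋂ z ∈ F, (fun ω : Z → Height => ω z) ⁻¹' {a | (a : ℕ) = 2} := by
    ext ω; simp [upSet]
  rw [h]
  exact isClopen_biInter_finset fun z _ => (isClopen_discrete _).preimage (continuous_apply z)

lemma measurableSet_upSet {Z : Type*} (F : Finset Z) : MeasurableSet (upSet F) := by
  have h : upSet F = ⋂ z ∈ F, (fun ω : Z → Height => ω z) ⁻¹' {a | (a : ℕ) = 2} := by
    ext ω; simp [upSet]
  rw [h]
  exact Finset.measurableSet_biInter _ fun z _ => measurable_pi_apply z (Set.to_countable _).measurableSet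

lemma isPiSystem_upSet (Z : Type*) :
    IsPiSystem (Set.range (upSet : Finset Z → Set (Z → Height))) := by
  classical
  rintro _ ⟨F, rfl⟩ _ ⟨G, rfl⟩ _
  refine ⟨F ∪ G, ?_⟩
  ext ω
  simp only [upSet, Finset.mem_union, Set.mem_inter_iff, Set.mem_ofPred_eq]
  grind

lemma generateFrom_upSet (Z : Type*) : (MeasurableSpace.pi : MeasurableSpace (Z → Height)) =
    MeasurableSpace.generateFrom (Set.range (upSet : Finset Z → Set (Z → Height))) := by
  refine le_antisymm ?_ (MeasurableSpace.generateFrom_le ?_)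
  · refine iSup_le fun z => ?_
    rw [← measurable_iff_comap_le]
    have h2 : MeasurableSet[MeasurableSpace.generateFrom
        (Set.range (upSet : Finset Z → Set (Z → Height)))] {ω : Z → Height | (ω z : ℕ) = 2} :=
      MeasurableSpace.measurableSet_generateFrom ⟨{z}, by simp [upSet]⟩
    refine @measurable_to_countable' Height (Z → Height) _ _ (MeasurableSpace.generateFrom _) _ fun a => ?_
    rcases height_eq_one_or_two a with ha | ha
    · have e : (fun ω : Z → Height => ω z) ⁻¹' {a} = {ω : Z → Height | (ω z : ℕ) = 2}ᶜ := by
        ext ω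
        have := height_eq_one_or_two (ω z)
        simp only [Set.mem_preimage, Set.mem_singleton_iff, Subtype.ext_iff, Set.mem_compl_iff,
          Set.mem_ofPred_eq]
        omega
      rw [e]; exact h2.compl
    · have e : (fun ω : Z → Height => ω z) ⁻¹' {a} = {ω : Z → Height | (ω z : ℕ) = 2} := by
        ext ω
        simp only [Set.mem_preimage, Set.mem_singleton_iff, Subtype.ext_iff, Set.mem_ofPred_eq]
        omega
      rw [e]; exact h2
  · rintro _ ⟨F, rfl⟩
    exact measurableSet_upSet F

lemma upSet_indicator_mono {Z : Type*} (F : Finset Z) :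
    Monotone ((upSet F).indicator fun _ => (1 : ℝ)) := by
  intro ω ω' h
  by_cases hω : ω ∈ upSet F
  · have hω' : ω' ∈ upSet F := fun z hz => by
      have h1 : (ω z : ℕ) ≤ ω' z := h z
      have h2 := hω z hz
      have := height_eq_one_or_two (ω' z)
      omega
    simp [hω, hω']
  · rw [Set.indicator_of_notMem hω]
    exact Set.indicator_nonneg (fun _ _ => zero_le_one) _

lemma upSet_indicator_continuous {Z : Type*} (F : Finset Z) :
    Continuous ((upSet F).indicator fun _ => (1 : ℝ)) :=
  (isClopen_upSet F).continuous_indicator continuous_const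

/-- A probability measure is determined by the integrals of continuous monotone functions. -/
lemma measure_ext_of_monotone {Z : Type*} {μ ν : Measure (Z → Height)} [IsProbabilityMeasure μ]
    [IsProbabilityMeasure ν]
    (h : ∀ f : (Z → Height) → ℝ, Continuous f → Monotone f → ∫ ω, f ω ∂μ = ∫ ω, f ω ∂ν) :
    μ = ν := by
  refine ext_of_generate_finite _ (generateFrom_upSet Z) (isPiSystem_upSet Z) ?_ (by simp)
  rintro _ ⟨F, rfl⟩
  have := h _ (upSet_indicator_continuous F) (upSet_indicator_mono F)
  erw [integral_indicator_one (measurableSet_upSet F),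
    integral_indicator_one (measurableSet_upSet F)] at this
  rwa [← measureReal_eq_measureReal_iff]

/-! ### Restrictions of configurations to boxes -/

lemma ofFinset_apply_eq_two {A : Finset ℤ} {x : ℤ} : (ofFinset A x : ℕ) = 2 ↔ x ∈ A := by
  unfold ofFinset; split_ifs with h <;> simp [h]

lemma ofFinset_mono : Monotone ofFinset := by
  intro A B h x
  rw [← Subtype.coe_le_coe]
  have hA := height_eq_one_or_two (ofFinset A x)
  have hB := height_eq_one_or_two (ofFinset B x)
  have : (ofFinset A x : ℕ) = 2 → (ofFinset B x : ℕ) = 2 := fun hx =>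
    ofFinset_apply_eq_two.2 (h (ofFinset_apply_eq_two.1 hx))
  omega

lemma mem_critIn {η : Config} {k : ℕ} {x : ℤ} : x ∈ critIn η k ↔ x ∈ box k ∧ (η x : ℕ) = 2 :=
  Finset.mem_filter

lemma critIn_subset (η : Config) (k : ℕ) : critIn η k ⊆ box k := Finset.filter_subset _ _

lemma critIn_mono (η : Config) : Monotone (critIn η) := fun _ _ h _ hx =>
  mem_critIn.2 ⟨box_mono h (mem_critIn.1 hx).1, (mem_critIn.1 hx).2⟩

lemma critIn_mono_left {η ζ : Config} (h : η ≤ ζ) (k : ℕ) : critIn η k ⊆ critIn ζ k := by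
  intro x hx
  rw [mem_critIn] at hx ⊢
  refine ⟨hx.1, ?_⟩
  have h1 : (η x : ℕ) ≤ ζ x := h x
  have := height_eq_one_or_two (ζ x)
  omega

/-- The restriction of `η` to `[-n,n]`, as a state of the box sandpile. -/
def boxOf (n : ℕ) (η : Config) : Box n := ⟨critIn η n, Finset.mem_powerset.2 (critIn_subset η n)⟩

lemma boxOf_ofFinset {n : ℕ} (A : Box n) : boxOf n (ofFinset A) = A := by
  ext x
  simp only [boxOf, mem_critIn, ofFinset_apply_eq_two]
  exact ⟨fun h => h.2, fun h => ⟨A.subset h, h⟩⟩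

lemma trunc_critIn {k N : ℕ} (h : k ≤ N) (η : Config) :
    (trunc N (critIn η k) : Finset ℤ) = critIn η k := by
  rw [trunc_of_subset ((critIn_subset η k).trans (box_mono h))]

lemma tendsto_ofFinset_critIn (η : Config) :
    Tendsto (fun n => ofFinset (critIn η n)) atTop (𝓝 η) := by
  rw [tendsto_pi_nhds]
  intro x
  refine tendsto_const_nhds.congr' ?_
  filter_upwards [eventually_ge_atTop x.natAbs] with n hn
  have h1 : x ∈ critIn η n ↔ (η x : ℕ) = 2 := by
    rw [mem_critIn, and_iff_right]
    rw [Finset.mem_Icc]; omega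
  rw [← ofFinset_apply_eq_two] at h1
  have h2 := height_eq_one_or_two (η x)
  have h3 := height_eq_one_or_two (ofFinset (critIn η n) x)
  ext
  omega

lemma continuous_comp_boxOf (n : ℕ) (F : Box n → ℝ) : Continuous fun η => F (boxOf n η) := by
  have h : (fun η => F (boxOf n η)) = (fun r : box n → Height => F (boxOf n fun x =>
      if hx : x ∈ box n then r ⟨x, hx⟩ else ⟨1, by simp⟩)) ∘ (box n).restrict := by
    ext η
    simp only [Function.comp]
    congr 1
    ext x
    simp only [boxOf, mem_critIn]
    refine and_congr_right fun hx => ?_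
    simp [hx]
  rw [h]
  exact continuous_of_discreteTopology.comp (Finset.continuous_restrict _)

lemma exists_abs_le {f : Config → ℝ} (hf : Continuous f) : ∃ C, ∀ η, |f η| ≤ C := by
  obtain ⟨C, hC⟩ := isCompact_univ.exists_bound_of_continuousOn hf.continuousOn
  exact ⟨C, fun η => hC η trivial⟩

/-- The expectation of `f` at time `t` for the sandpile on `[-n,n]` started from `η`. -/
def boxExp (n : ℕ) (t : ℝ) (f : Config → ℝ) (η : Config) : ℝ :=
  boxFlow n n t (fun B => f (ofFinset B)) (boxOf n η)

lemma boxExp_mono_nat {f : Config → ℝ} (hf : Monotone f) {t : ℝ} (ht : 0 ≤ t) (η : Config) :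
    Monotone fun n => boxExp n t f η :=
  fun _ _ h => boxFlow_le_boxFlow h le_rfl le_rfl h (fun _ _ hAB => hf (ofFinset_mono hAB)) ht
    (critIn_mono η h)

lemma boxExp_mono {f : Config → ℝ} (hf : Monotone f) {t : ℝ} (ht : 0 ≤ t) (n : ℕ) :
    Monotone (boxExp n t f) :=
  fun _ _ h => boxFlow_le_boxFlow le_rfl le_rfl le_rfl le_rfl
    (fun _ _ hAB => hf (ofFinset_mono hAB)) ht (critIn_mono_left h n)

lemma boxExp_le_boxExp {f g : Config → ℝ} (hfg : ∀ ζ, f ζ ≤ g ζ) {t : ℝ} (ht : 0 ≤ t) (n : ℕ)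
    (η : Config) : boxExp n t f η ≤ boxExp n t g η :=
  flow_mono (fun _ => hfg _) ht _

lemma continuous_boxExp (n : ℕ) (t : ℝ) (f : Config → ℝ) : Continuous (boxExp n t f) :=
  continuous_comp_boxOf n fun A => boxFlow n n t (fun B => f (ofFinset B)) A

lemma boxExp_const (n : ℕ) (t c : ℝ) (η : Config) : boxExp n t (fun _ => c) η = c :=
  boxFlow_const _ _ _ _ _

lemma abs_boxExp_le {f : Config → ℝ} {C : ℝ} (hC : ∀ η, |f η| ≤ C) {t : ℝ} (ht : 0 ≤ t) (n : ℕ)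
    (η : Config) : |boxExp n t f η| ≤ C := by
  rw [abs_le]
  constructor
  · rw [← boxExp_const n t (-C) η]
    exact boxExp_le_boxExp (fun ζ => neg_le_of_abs_le (hC ζ)) ht n η
  · rw [← boxExp_const n t C η]
    exact boxExp_le_boxExp (fun ζ => le_of_abs_le (hC ζ)) ht n η

lemma boxExp_add (n : ℕ) (s t : ℝ) (f : Config → ℝ) (η : Config) :
    boxExp n (s + t) f η = boxExp n s (boxExp n t f) η := by
  rw [boxExp, boxFlow, flow_add]
  simp only [boxExp, boxOf_ofFinset]
  rfl

/-- The law at time `t` of the sandpile on `[-n,n]` started from `η`. -/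
def boxLaw (n : ℕ) (t : ℝ≥0) (η : Config) : Measure Config :=
  ∑ C : Box n, ENNReal.ofReal (boxFlow n n t (fun D => if D = C then 1 else 0) (boxOf n η)) •
    Measure.dirac (ofFinset C)

lemma boxFlow_single_nonneg (n N : ℕ) (t : ℝ≥0) (A C : Box N) :
    0 ≤ boxFlow n N t (fun D => if D = C then (1 : ℝ) else 0) A :=
  boxFlow_nonneg t.2 (fun D => by split_ifs <;> simp) A

instance (n : ℕ) (t : ℝ≥0) (η : Config) : IsProbabilityMeasure (boxLaw n t η) := ⟨by
  have h := boxFlow_eq_sum n n t (fun _ => 1) (boxOf n η)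
  rw [boxFlow_const] at h
  simp only [one_mul] at h
  simp only [boxLaw, Measure.finsetSum_apply, Measure.smul_apply, measure_univ, smul_eq_mul, mul_one]
  rw [← ENNReal.ofReal_sum_of_nonneg fun C _ => boxFlow_single_nonneg n n t _ C, ← h,
    ENNReal.ofReal_one]⟩

lemma integral_boxLaw (n : ℕ) (t : ℝ≥0) (η : Config) {f : Config → ℝ} (hf : Continuous f) :
    ∫ ω, f ω ∂(boxLaw n t η) = boxExp n t f η := by
  obtain ⟨C, hC⟩ := exists_abs_le hf
  rw [boxLaw, integral_finsetSum_measure, boxExp, boxFlow_eq_sum]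
  · refine Finset.sum_congr rfl fun D _ => ?_
    rw [integral_smul_measure, integral_dirac,
      ENNReal.toReal_ofReal (boxFlow_single_nonneg n n t _ D), smul_eq_mul, mul_comm]
  · intro D _
    refine Integrable.smul_measure ?_ ENNReal.ofReal_ne_top
    exact Integrable.of_bound hf.aestronglyMeasurable C (Eventually.of_forall hC)

/-- Probability measures on the compact space `Config` form a compact space, so the box laws
converge along an ultrafilter. For monotone `f` the expectations increase with `n` and converge
along the whole sequence, necessarily to the integral against that limit. -/
lemma exists_limitLaw (t : ℝ≥0) (η : Config) : ∃ μ : ProbabilityMeasure Config,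
    ∀ f : Config → ℝ, Continuous f → Monotone f →
      Tendsto (fun n => boxExp n t f η) atTop (𝓝 (∫ ω, f ω ∂(μ : Measure Config))) := by
  let ν : ℕ → ProbabilityMeasure Config := fun n => ⟨boxLaw n t η, inferInstance⟩
  obtain ⟨μ, -, hμ⟩ := isCompact_univ.ultrafilter_le_nhds ((hyperfilter ℕ).map ν) (by simp)
  refine ⟨μ, fun f hf hm => ?_⟩
  obtain ⟨C, hC⟩ := exists_abs_le hf
  have h1 := tendsto_atTop_ciSup (boxExp_mono_nat hm t.2 η) ⟨C, by
    rintro _ ⟨n, rfl⟩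
    exact le_of_abs_le (abs_boxExp_le hC t.2 n η)⟩
  have h2 : Tendsto (fun n => boxExp n t f η) (hyperfilter ℕ)
      (𝓝 (∫ ω, f ω ∂(μ : Measure Config))) := by
    have := (ProbabilityMeasure.tendsto_iff_forall_integral_tendsto (F := (hyperfilter ℕ : Filter ℕ))
      (μs := ν)).1 hμ (BoundedContinuousFunction.ofNormedAddCommGroup f hf C hC)
    refine this.congr fun n => ?_
    exact integral_boxLaw n t η hf
  rwa [tendsto_nhds_unique h2 (h1.mono_left Nat.hyperfilter_le_atTop)]

/-! ### The transition kernels of the infinite volume process -/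

/-- The law of the sandpile process at time `t` started from `η`. -/
def limitLaw (t : ℝ≥0) (η : Config) : Measure Config := (exists_limitLaw t η).choose

instance (t : ℝ≥0) (η : Config) : IsProbabilityMeasure (limitLaw t η) :=
  inferInstanceAs (IsProbabilityMeasure ((exists_limitLaw t η).choose : Measure Config))

lemma tendsto_boxExp (t : ℝ≥0) (η : Config) {f : Config → ℝ} (hf : Continuous f)
    (hm : Monotone f) :
    Tendsto (fun n => boxExp n t f η) atTop (𝓝 (∫ ω, f ω ∂(limitLaw t η))) :=
  (exists_limitLaw t η).choose_spec f hf hm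

lemma boxExp_le_integral (t : ℝ≥0) (η : Config) {f : Config → ℝ} (hf : Continuous f)
    (hm : Monotone f) (n : ℕ) : boxExp n t f η ≤ ∫ ω, f ω ∂(limitLaw t η) :=
  (boxExp_mono_nat hm t.2 η).ge_of_tendsto (tendsto_boxExp t η hf hm) n

lemma measurable_limitLaw (t : ℝ≥0) : Measurable (limitLaw t) := by
  refine Measurable.measure_of_isPiSystem_of_isProbabilityMeasure (generateFrom_upSet ℤ)
    (isPiSystem_upSet ℤ) ?_
  rintro _ ⟨F, rfl⟩
  have h : ∀ η, limitLaw t η (upSet F) =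
      ENNReal.ofReal (∫ ω, (upSet F).indicator (fun _ => (1 : ℝ)) ω ∂(limitLaw t η)) := by
    intro η
    erw [integral_indicator_one (measurableSet_upSet F)]
    exact (ofReal_measureReal).symm
  simp only [h]
  refine (measurable_of_tendsto_metrizable (f := fun n => boxExp n t _) (fun n =>
    (continuous_boxExp n t _).measurable) (tendsto_pi_nhds.2 fun η =>
      tendsto_boxExp t η (upSet_indicator_continuous F) (upSet_indicator_mono F))).ennreal_ofReal

/-- The transition kernel of the sandpile process. -/
def transKernel (t : ℝ≥0) : Kernel Config Config := ⟨limitLaw t, measurable_limitLaw t⟩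

instance (t : ℝ≥0) : IsMarkovKernel (transKernel t) :=
  ⟨fun η => inferInstanceAs (IsProbabilityMeasure (limitLaw t η))⟩

lemma transKernel_zero (η : Config) : transKernel 0 η = Measure.dirac η := by
  refine measure_ext_of_monotone fun f hf hm => ?_
  rw [integral_dirac]
  refine tendsto_nhds_unique (tendsto_boxExp 0 η hf hm) ?_
  have : ∀ n, boxExp n (0 : ℝ≥0) f η = f (ofFinset (critIn η n)) := fun n => by
    rw [boxExp, boxFlow, NNReal.coe_zero, flow_zero]; rfl
  simp only [this]
  exact (hf.tendsto η).comp (tendsto_ofFinset_critIn η)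

/-- The Chapman-Kolmogorov equation. -/
lemma transKernel_add (s t : ℝ≥0) : transKernel (s + t) = transKernel t ∘ₖ transKernel s := by
  ext1 η
  refine measure_ext_of_monotone fun f hf hm => ?_
  obtain ⟨C, hC⟩ := exists_abs_le hf
  have hint : ∀ μ : Measure Config, [IsProbabilityMeasure μ] → Integrable f μ := fun μ _ =>
    Integrable.of_bound hf.aestronglyMeasurable C (Eventually.of_forall hC)
  rw [Kernel.integral_comp (hint _)]
  have hlim : Tendsto (fun n => ∫ ζ, boxExp n t f ζ ∂(transKernel s η)) atTop
      (𝓝 (∫ ζ, ∫ ω, f ω ∂(transKernel t ζ) ∂(transKernel s η))) := by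
    refine tendsto_integral_of_dominated_convergence (fun _ => C)
      (fun n => (continuous_boxExp n t f).aestronglyMeasurable) (integrable_const C)
      (fun n => Eventually.of_forall fun ζ => abs_boxExp_le hC t.2 n ζ)
      (Eventually.of_forall fun ζ => tendsto_boxExp t ζ hf hm)
  have hmono : Monotone fun n => ∫ ζ, boxExp n t f ζ ∂(transKernel s η) := fun m n hmn =>
    integral_mono
      (Integrable.of_bound (continuous_boxExp m t f).aestronglyMeasurable C
        (Eventually.of_forall fun ζ => abs_boxExp_le hC t.2 m ζ))
      (Integrable.of_bound (continuous_boxExp n t f).aestronglyMeasurable C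
        (Eventually.of_forall fun ζ => abs_boxExp_le hC t.2 n ζ))
      (fun ζ => boxExp_mono_nat hm t.2 ζ hmn)
  have hst := tendsto_boxExp (s + t) η hf hm
  have hadd : ∀ n, boxExp n (s + t : ℝ≥0) f η = boxExp n s (boxExp n t f) η := fun n => by
    rw [NNReal.coe_add, boxExp_add]
  -- Write `S_n` for the box semigroup and `P` for the limit kernel. One direction is `S_n(s) S_n(t)
  -- f ≤ P_s S_n(t) f ≤ P_s P_t f`. For the other, `S_n(s) S_m(t) f ≤ S_n(s+t) f` when `m ≤ n`;
  -- first `n`, then `m` tends to infinity.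
  refine le_antisymm ?_ ?_
  · refine le_of_tendsto' hst fun n => ?_
    rw [hadd]
    exact (boxExp_le_integral s η (continuous_boxExp n t f) (boxExp_mono hm t.2 n) n).trans
      (hmono.ge_of_tendsto hlim n)
  · refine le_of_tendsto' hlim fun m => ?_
    refine le_of_tendsto_of_tendsto
      (tendsto_boxExp s η (continuous_boxExp m t f) (boxExp_mono hm t.2 m)) hst ?_
    filter_upwards [eventually_ge_atTop m] with n hn
    rw [hadd]
    exact boxExp_le_boxExp (fun ζ => boxExp_mono_nat hm t.2 ζ hn) s.2 n η

/-! ### The semigroup of the finite chains -/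

/-- The iterated limit of the semigroups of the finite chains. -/
lemma exists_tendsto_semigroup (t : ℝ≥0) (η : Config) {f : Config → ℝ} (hf : Continuous f)
    (hm : Monotone f) :
    ∃ g : ℕ → ℝ, (∀ n, Tendsto (fun k => semigroup n t f (critIn η k)) atTop (𝓝 (g n))) ∧
      Tendsto g atTop (𝓝 (∫ ω, f ω ∂(transKernel t η))) := by
  obtain ⟨C, hC⟩ := exists_abs_le hf
  have hlim : ∀ n A, Tendsto (fun N => boxFlow n N t (fun B => f (ofFinset B)) (trunc N A)) atTop
      (𝓝 (semigroup n t f A)) := fun n A => tendsto_boxFlow n t (fun B => hC (ofFinset B)) A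
  have hmono : ∀ n, Monotone fun k => semigroup n t f (critIn η k) := by
    intro n k l hkl
    refine le_of_tendsto_of_tendsto (hlim n _) (hlim n _) ?_
    filter_upwards [eventually_ge_atTop n] with N hN
    exact boxFlow_le_boxFlow le_rfl hN hN le_rfl (fun _ _ hAB => hm (ofFinset_mono hAB)) t.2
      (Finset.inter_subset_inter_right (critIn_mono η hkl))
  -- In a large box, allowing births everywhere instead of in `[-n,n]` only increases the
  -- expectation.
  have hupper : ∀ n k, semigroup n t f (critIn η k) ≤ ∫ ω, f ω ∂(transKernel t η) := by
    intro n k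
    refine le_of_tendsto (hlim n _) ?_
    filter_upwards [eventually_ge_atTop (max n k)] with N hN
    refine le_trans ?_ (boxExp_le_integral t η hf hm N)
    refine boxFlow_le_boxFlow (le_of_max_le_left hN) (le_of_max_le_left hN) le_rfl le_rfl
      (fun _ _ hAB => hm (ofFinset_mono hAB)) t.2 ?_
    rw [trunc_critIn (le_of_max_le_right hN)]
    exact critIn_mono η (le_of_max_le_right hN)
  -- With the same births in `[-n,n]`, moving the sinks from the ends of `[-n,n]` to those of a
  -- larger box only increases the expectation.
  have hlower : ∀ n, boxExp n t f η ≤ semigroup n t f (critIn η n) := by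
    intro n
    refine ge_of_tendsto (hlim n _) ?_
    filter_upwards [eventually_ge_atTop n] with N hN
    refine boxFlow_le_boxFlow le_rfl le_rfl hN hN (fun _ _ hAB => hm (ofFinset_mono hAB)) t.2 ?_
    rw [trunc_critIn hN]
    exact subset_rfl
  have hg : ∀ n, Tendsto (fun k => semigroup n t f (critIn η k)) atTop
      (𝓝 (⨆ k, semigroup n t f (critIn η k))) := fun n =>
    tendsto_atTop_ciSup (hmono n) ⟨_, by rintro _ ⟨k, rfl⟩; exact hupper n k⟩
  refine ⟨_, hg, tendsto_of_tendsto_of_tendsto_of_le_of_le (tendsto_boxExp t η hf hm)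
    tendsto_const_nhds (fun n => ?_) fun n => ?_⟩
  · exact (hlower n).trans ((hmono n).ge_of_tendsto (hg n) n)
  · exact le_of_tendsto' (hg n) (hupper n)

/-! ### The box sandpile fills up -/

/-- The tent function on `[-N-1,N+1]` with value one at `x` and zero at the end points. -/
def tent (N : ℕ) (x i : ℤ) : ℝ :=
  if i ≤ x then (i + N + 1) / (x + N + 1) else (N + 1 - i) / (N + 1 - x)

section Tent

variable {N : ℕ} {x i : ℤ}

lemma tent_of_le (h : i ≤ x) : tent N x i = (i + N + 1) / (x + N + 1) := if_pos h

lemma cast_bounds (hx : x ∈ box N) : -(N : ℝ) ≤ x ∧ (x : ℝ) ≤ N := by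
  rw [Finset.mem_Icc] at hx
  exact ⟨by exact_mod_cast hx.1, by exact_mod_cast hx.2⟩

lemma tent_of_ge (hx : x ∈ box N) (h : x ≤ i) : tent N x i = (N + 1 - i) / (N + 1 - x) := by
  have := cast_bounds hx
  rcases h.eq_or_lt with rfl | h
  · rw [tent_of_le le_rfl, div_self (by linarith), div_self (by linarith)]
  · exact if_neg (not_le.2 h)

lemma tent_nonneg (hx : x ∈ box N) (hi : i ∈ box N) : 0 ≤ tent N x i := by
  have h1 := cast_bounds hx
  have h2 := cast_bounds hi
  unfold tent
  split_ifs
  · exact div_nonneg (by linarith) (by linarith)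
  · exact div_nonneg (by linarith) (by linarith)

lemma tent_le_one (hx : x ∈ box N) : tent N x i ≤ 1 := by
  have h1 := cast_bounds hx
  rcases le_total i x with h | h
  · have : (i : ℝ) ≤ x := by exact_mod_cast h
    rw [tent_of_le h, div_le_one (by linarith)]; linarith
  · have : (x : ℝ) ≤ i := by exact_mod_cast h
    rw [tent_of_ge hx h, div_le_one (by linarith)]; linarith

lemma tent_eq_zero (hx : x ∈ box N) (hi : i ∈ box (N + 1)) (hi' : i ∉ box N) :
    tent N x i = 0 := by
  rw [Finset.mem_Icc] at hx hi hi'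
  push_cast at hi
  have : i = -(N + 1 : ℤ) ∨ i = N + 1 := by omega
  rcases this with rfl | rfl
  · rw [tent_of_le (by omega)]; push_cast; simp
  · rw [tent_of_ge (Finset.mem_Icc.2 hx) (by omega)]; push_cast; simp

/-- The tent function is affine on blocks that do not contain its summit. -/
lemma tent_add_tent (hx : x ∈ box N) {lo hi : ℤ} (h1 : lo < i) (h2 : i < hi)
    (h : x ≤ lo ∨ hi ≤ x) :
    tent N x lo + tent N x hi = tent N x i + tent N x (lo + hi - i) := by
  rcases h with h | h
  · rw [tent_of_ge hx h, tent_of_ge hx (by omega), tent_of_ge hx (by omega),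
      tent_of_ge hx (by omega)]
    push_cast; ring
  · rw [tent_of_le (by omega), tent_of_le h, tent_of_le (by omega), tent_of_le (by omega)]
    push_cast; ring

/-- The integral of the tent function over the critical sites. -/
def tentMass (N : ℕ) (x : ℤ) (A : Finset ℤ) : ℝ := ∑ i ∈ A, tent N x i

lemma tentMass_le (hx : x ∈ box N) {A : Finset ℤ} (hA : A ⊆ box N) :
    tentMass N x A ≤ tentMass N x (box N) :=
  Finset.sum_le_sum_of_subset_of_nonneg hA fun _ hi _ => tent_nonneg hx hi

lemma tentMass_box_le (hx : x ∈ box N) : tentMass N x (box N) ≤ (box N).card :=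
  (Finset.sum_le_sum fun _ _ => tent_le_one hx).trans (by simp)

/-- Wherever the summit lies, the tent is at least `1/4` on the middle half of the box, which has at
least `N` sites. -/
lemma le_tentMass_box (hx : x ∈ box N) : (N / 4 : ℝ) ≤ tentMass N x (box N) := by
  have hsub : box (N / 2) ⊆ box N := box_mono (Nat.div_le_self N 2)
  have h1 := cast_bounds hx
  have h2 : ∀ i ∈ box (N / 2), (1 / 4 : ℝ) ≤ tent N x i := by
    intro i hi
    have h3 := cast_bounds hi
    have h4 : ((N / 2 : ℕ) : ℝ) ≤ N / 2 := Nat.cast_div_le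
    rcases le_total i x with h | h
    · rw [tent_of_le h, div_le_div_iff₀ (by norm_num) (by linarith)]; linarith
    · rw [tent_of_ge hx h, div_le_div_iff₀ (by norm_num) (by linarith)]; linarith
  calc (N / 4 : ℝ) ≤ ∑ i ∈ box (N / 2), (1 / 4 : ℝ) := by
        rw [Finset.sum_const, card_box, nsmul_eq_mul]
        have : (N : ℝ) ≤ (2 * (N / 2) + 1 : ℕ) := by exact_mod_cast (by omega)
        linarith
    _ ≤ ∑ i ∈ box (N / 2), tent N x i := Finset.sum_le_sum h2
    _ ≤ _ := tentMass_le hx hsub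

/-- The sites that topple when a grain is added at `i`. -/
def toppledSites (i : ℤ) (A : Finset ℤ) : Finset ℤ :=
  if i ∈ A then Finset.Ioo (i - (kMinus i A : ℤ)) (i + (kPlus i A : ℤ)) else ∅

lemma IsBlock.toppledSites_eq {A : Finset ℤ} {lo hi : ℤ} (h : IsBlock A lo hi) (h1 : lo < i)
    (h2 : i < hi) : toppledSites i A = Finset.Ioo lo hi := by
  rw [toppledSites, if_pos (h.mem i h1 h2), h.add_kPlus h1 h2, h.sub_kMinus h1 h2]

/-- An avalanche replaces the mirror image of `i` by the two ends of the block. If the summit is not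
strictly inside the block, the tent is affine on it and the gain is exactly the tent at `i`. Grains
lost at the sinks cost nothing, as the tent vanishes there. -/
lemma tentMass_topple (hx : x ∈ box N) (hi : i ∈ box N) (A : Box N)
    (hxA : x ∉ toppledSites i A) :
    tentMass N x (trunc N (topple i A)) = tentMass N x A + tent N x i := by
  have h1 : tentMass N x (trunc N (topple i A)) = tentMass N x (topple i A) := by
    refine Finset.sum_subset Finset.inter_subset_left fun j hj hj' => ?_
    refine tent_eq_zero hx (topple_subset_box A.subset hi hj) fun h => hj' ?_
    exact Finset.mem_inter.2 ⟨hj, h⟩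
  rw [h1]
  by_cases hiA : i ∈ (A : Finset ℤ)
  · obtain ⟨lo, hi, h1, h2, hb⟩ := exists_isBlock hiA
    rw [hb.toppledSites_eq h1 h2, Finset.mem_Ioo] at hxA
    have ht := tent_add_tent hx h1 h2 (by omega)
    have hlo := hb.lo_notMem
    have hhi := hb.hi_notMem
    rw [hb.topple_eq h1 h2, tentMass, Finset.sum_insert (by simp [hhi]; omega),
      Finset.sum_insert (by simp [hlo]), Finset.sum_erase_eq_sub (hb.mem _ (by omega) (by omega)),
      tentMass]
    linarith
  · rw [topple_of_notMem hiA, tentMass, Finset.sum_insert hiA, tentMass, add_comm]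

end Tent

/-! ### Untoppled sites, and why two holes are unlikely at time six -/

/-- The box sandpile together with a set of sites which have not toppled. -/
def trackMap (N : ℕ) (i : ℤ) (s : Box N × Box N) : Box N × Box N :=
  (addGrain N N i s.1, trunc N ((s.2 : Finset ℤ) \ toppledSites i s.1))

lemma addGrain_self {N : ℕ} {i : ℤ} (hi : i ∈ box N) (A : Box N) :
    addGrain N N i A = trunc N (topple i A) := if_pos (Finset.mem_union_right _ hi)

/-- Between any two holes there is a site of the second component. -/
def Separated {N : ℕ} (s : Box N × Box N) : Prop :=
  ∀ y ∈ box N, ∀ z ∈ box N, y ∉ (s.1 : Finset ℤ) → z ∉ (s.1 : Finset ℤ) → y < z →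
    ∃ x ∈ (s.2 : Finset ℤ), y ≤ x ∧ x ≤ z

/-- An avalanche topples exactly the interior of its block and leaves a single hole in the closed
block. Of two holes present afterwards, one therefore lies outside the block. It was a hole before,
and so was the end of the block on its side; the separator on that side is not in the interior and
survives. -/
lemma Separated.trackMap {N : ℕ} {s : Box N × Box N} (h : Separated s) {i : ℤ} (hi : i ∈ box N) :
    Separated (trackMap N i s) := by
  obtain ⟨A, U⟩ := s
  intro y hy z hz hyA hzA hyz
  simp only [Sandpile.trackMap, addGrain_self hi, coe_trunc, Finset.mem_inter, hy, hz,
    and_true] at hyA hzA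
  have key : ∀ x ∈ (U : Finset ℤ), x ∉ toppledSites i A →
      x ∈ ((Sandpile.trackMap N i (A, U)).2 : Finset ℤ) := fun x hx hx' => by
    simp [Sandpile.trackMap, hx, hx', Finset.mem_Icc.1 (U.subset hx)]
  by_cases hiA : i ∈ (A : Finset ℤ)
  · obtain ⟨lo, hi', h1, h2, hb⟩ := exists_isBlock hiA
    rw [hb.topple_eq h1 h2] at hyA hzA
    simp only [Finset.mem_insert, Finset.mem_erase, not_or, not_and] at hyA hzA
    rw [hb.toppledSites_eq h1 h2] at key
    have hlo := hb.lo_notMem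
    have hhi := hb.hi_notMem
    rw [Finset.mem_Icc] at hy hz
    have hyA' : y ≤ lo ∨ hi' ≤ y → y ∉ (A : Finset ℤ) := fun h' hyA' => by
      have := mt hyA.2.2 (fun h => h hyA'); omega
    have hzA' : z ≤ lo ∨ hi' ≤ z → z ∉ (A : Finset ℤ) := fun h' hzA' => by
      have := mt hzA.2.2 (fun h => h hzA'); omega
    rcases lt_or_ge y lo with hylo | hylo
    · obtain ⟨w, hwz, hwlo, hwbox, hwA⟩ : ∃ w, w ≤ z ∧ w ≤ lo ∧ (y < w ∧ w ≤ N) ∧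
          w ∉ (A : Finset ℤ) := by
        rcases le_total z lo with hz' | hz'
        · exact ⟨z, le_rfl, hz', ⟨hyz, hz.2⟩, hzA' (.inl hz')⟩
        · exact ⟨lo, hz', le_rfl, ⟨hylo, by omega⟩, hlo⟩
      obtain ⟨x, hx, hyx, hxw⟩ := h y (Finset.mem_Icc.2 hy) w (Finset.mem_Icc.2 (by omega))
        (hyA' (.inl hylo.le)) hwA hwbox.1
      exact ⟨x, key x hx (by rw [Finset.mem_Ioo]; omega), hyx, by omega⟩
    · have hzhi : hi' < z := by
        by_contra! hle
        have hz1 : z ≠ hi' := hzA.1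
        have hy1 : y ≠ lo := hyA.2.1
        have hyA2 : y ∈ (A : Finset ℤ) := hb.mem y (by omega) (by omega)
        have hzA2 : z ∈ (A : Finset ℤ) := hb.mem z (by omega) (by omega)
        have e1 : y = lo + hi' - i := by
          by_contra hne; exact hyA.2.2 hne hyA2
        have e2 : z = lo + hi' - i := by
          by_contra hne; exact hzA.2.2 hne hzA2
        omega
      obtain ⟨w, hwy, hwhi, hwbox, hwA⟩ : ∃ w, y ≤ w ∧ hi' ≤ w ∧ (w < z ∧ -(N : ℤ) ≤ w) ∧
          w ∉ (A : Finset ℤ) := by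
        rcases le_total y hi' with hy' | hy'
        · exact ⟨hi', hy', le_rfl, ⟨hzhi, by omega⟩, hhi⟩
        · exact ⟨y, le_rfl, hy', ⟨hyz, hy.1⟩, hyA' (.inr hy')⟩
      obtain ⟨x, hx, hwx, hxz⟩ := h w (Finset.mem_Icc.2 (by omega)) z (Finset.mem_Icc.2 hz)
        hwA (hzA' (.inr hzhi.le)) hwbox.1
      exact ⟨x, key x hx (by rw [Finset.mem_Ioo]; omega), by omega, hxz⟩
  · rw [topple_of_notMem hiA, Finset.mem_insert, not_or] at hyA hzA
    obtain ⟨x, hx, hyx⟩ := h y hy z hz hyA.2 hzA.2 hyz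
    exact ⟨x, key x hx (by simp [toppledSites, hiA]), hyx⟩

/-- The exponential weight of the event that `x` has not toppled. -/
def trackWeight (N : ℕ) (x : ℤ) (s : Box N × Box N) : ℝ :=
  if x ∈ (s.2 : Finset ℤ) then Real.exp (tentMass N x (box N) - tentMass N x s.1) else 0

lemma trackWeight_nonneg (N : ℕ) (x : ℤ) (s : Box N × Box N) : 0 ≤ trackWeight N x s := by
  unfold trackWeight; split_ifs <;> positivity

lemma exp_neg_le {h : ℝ} (h0 : 0 ≤ h) (h1 : h ≤ 1) : Real.exp (-h) ≤ 1 - h / 2 := by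
  rw [Real.exp_neg, inv_le_comm₀ (Real.exp_pos h) (by linarith)]
  refine le_trans ?_ (Real.add_one_le_exp h)
  rw [inv_le_comm₀ (by linarith) (by linarith), inv_le_iff_one_le_mul₀ (by linarith)]
  nlinarith

/-- A grain at `i` either makes `x` topple, killing the weight, or multiplies the weight by `exp
(-tent N x i) ≤ 1 - tent N x i / 2`. Summing over `i` gives a decay rate of half the tent mass of
the box. -/
lemma sum_trackWeight_le {N : ℕ} {x : ℤ} (hx : x ∈ box N) (s : Box N × Box N) :
    ∑ i ∈ box N, trackWeight N x (trackMap N i s) ≤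
      ((box N).card - tentMass N x (box N) / 2) * trackWeight N x s := by
  have h : ∀ i ∈ box N, trackWeight N x (trackMap N i s) ≤
      (1 - tent N x i / 2) * trackWeight N x s := by
    intro i hi
    have hle : 0 ≤ 1 - tent N x i / 2 := by linarith [tent_le_one (i := i) hx]
    by_cases hxU : x ∈ ((trackMap N i s).2 : Finset ℤ)
    · have hxU' := hxU
      simp only [trackMap, coe_trunc, Finset.mem_inter, Finset.mem_sdiff] at hxU'
      rw [trackWeight, if_pos hxU, trackWeight, if_pos hxU'.1.1]
      simp only [trackMap, addGrain_self hi]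
      rw [tentMass_topple hx hi s.1 hxU'.1.2, ← sub_sub, sub_eq_add_neg _ (tent N x i),
        Real.exp_add, mul_comm]
      gcongr
      exact exp_neg_le (tent_nonneg hx hi) (tent_le_one hx)
    · rw [trackWeight, if_neg hxU]
      exact mul_nonneg hle (trackWeight_nonneg N x s)
  refine (Finset.sum_le_sum h).trans_eq ?_
  rw [← Finset.sum_mul, Finset.sum_sub_distrib, tentMass, Finset.sum_div]
  simp

/-- The configuration has at least two holes in the box. -/
def TwoHoles {N : ℕ} (A : Box N) : Prop :=
  ∃ y ∈ box N, ∃ z ∈ box N, y ∉ (A : Finset ℤ) ∧ z ∉ (A : Finset ℤ) ∧ y < z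

open Classical in
-- Two holes force an untoppled site `x` in the box, whose weight is then at least one, so a union
-- bound over `x` applies. With `K` the tent mass of the full box, the weight starts at `exp K` and
-- decays at rate `K / 2`; by time six its mean is at most `exp (K - 3 * K)`, and `2 * K ≥ N / 2`.
lemma boxFlow_twoHoles_le (N : ℕ) {t : ℝ} (ht : 6 ≤ t) :
    boxFlow N N t (fun A => if TwoHoles A then 1 else 0) (trunc N ∅) ≤
      (2 * N + 1) * Real.exp (-(N / 2)) := by
  have ht0 : 0 ≤ t := by linarith
  calc boxFlow N N t (fun A => if TwoHoles A then 1 else 0) (trunc N ∅)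
      ≤ flow (box N) (trackMap N) t (∑ x ∈ box N, trackWeight N x)
          (trunc N ∅, trunc N (box N)) := by
        refine flow_le_flow_of_rel
          (R := fun (A : Box N) (s : Box N × Box N) => s.1 = A ∧ Separated s) ?_ ?_ ht0 ?_
        · rintro i hi _ s ⟨rfl, hs⟩
          exact ⟨rfl, hs.trackMap hi⟩
        · rintro _ s ⟨rfl, hs⟩
          rw [Finset.sum_apply]
          split_ifs with h
          · obtain ⟨y, hy, z, hz, hyA, hzA, hyz⟩ := h
            obtain ⟨x, hx, -⟩ := hs y hy z hz hyA hzA hyz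
            have hxb := s.2.subset hx
            refine le_trans ?_ (Finset.single_le_sum (fun i _ => trackWeight_nonneg N i s) hxb)
            rw [trackWeight, if_pos hx, Real.one_le_exp_iff, sub_nonneg]
            exact tentMass_le hxb s.1.subset
          · exact Finset.sum_nonneg fun i _ => trackWeight_nonneg N i s
        · refine ⟨rfl, fun y hy z hz _ _ hyz => ⟨y, ?_, le_rfl, hyz.le⟩⟩
          simpa using hy
    _ = ∑ x ∈ box N, flow (box N) (trackMap N) t (trackWeight N x)
          (trunc N ∅, trunc N (box N)) := by rw [map_sum, Finset.sum_apply]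
    _ ≤ ∑ x ∈ box N, Real.exp (-(N / 2)) := by
        refine Finset.sum_le_sum fun x hx => ?_
        have hK := le_tentMass_box hx
        have hN : (0 : ℝ) ≤ N := Nat.cast_nonneg N
        refine (flow_le_of_sumComp_le (I := fun _ => True) (fun _ _ _ _ => trivial)
          (c := tentMass N x (box N) / 2) ?_ (fun s _ => sum_trackWeight_le hx s) ht0
          trivial).trans ?_
        · linarith [tentMass_box_le hx]
        · have h0 : trackWeight N x (trunc N ∅, trunc N (box N)) =
              Real.exp (tentMass N x (box N)) := by
            rw [trackWeight, if_pos (by simpa using hx)]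
            simp [tentMass]
          rw [h0, ← Real.exp_add, Real.exp_le_exp]
          nlinarith
    _ = _ := by
        rw [Finset.sum_const, card_box, nsmul_eq_mul]; push_cast; rfl

/-! ### Dynamics of a single hole -/

lemma not_twoHoles_addGrain {N : ℕ} {i : ℤ} (hi : i ∈ box N) {A : Box N} (hA : ¬ TwoHoles A) :
    ¬ TwoHoles (addGrain N N i A) := by
  have huniq : ∀ y ∈ box N, ∀ z ∈ box N, y ∉ (A : Finset ℤ) → z ∉ (A : Finset ℤ) → y = z := by
    intro y hy z hz hyA hzA
    by_contra hne
    rcases lt_or_gt_of_ne hne with h | h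
    · exact hA ⟨y, hy, z, hz, hyA, hzA, h⟩
    · exact hA ⟨z, hz, y, hy, hzA, hyA, h⟩
  rintro ⟨y, hy, z, hz, hyA, hzA, hyz⟩
  simp only [addGrain_self hi, coe_trunc, Finset.mem_inter, hy, hz, and_true] at hyA hzA
  by_cases hiA : i ∈ (A : Finset ℤ)
  · obtain ⟨lo, hi', h1, h2, hb⟩ := exists_isBlock hiA
    rw [hb.topple_eq h1 h2] at hyA hzA
    simp only [Finset.mem_insert, Finset.mem_erase, not_or, not_and] at hyA hzA
    -- Only one of the two holes can be the one just created; the other, `p`, is an old hole and not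
    -- an end of the block. By uniqueness both ends lie outside the box, which places `p` inside the
    -- block, a contradiction.
    obtain ⟨p, hp, hpA, hplo, hphi⟩ : ∃ p ∈ box N, p ∉ (A : Finset ℤ) ∧ p ≠ lo ∧ p ≠ hi' := by
      by_cases hyr : y = lo + hi' - i
      · exact ⟨z, hz, hzA.2.2 (by omega), hzA.2.1, hzA.1⟩
      · exact ⟨y, hy, hyA.2.2 hyr, hyA.2.1, hyA.1⟩
    have hlo : lo ∉ box N := fun h => hplo (huniq p hp lo h hpA hb.lo_notMem)
    have hhi : hi' ∉ box N := fun h => hphi (huniq p hp hi' h hpA hb.hi_notMem)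
    rw [Finset.mem_Icc] at hlo hhi hp hi
    exact hpA (hb.mem p (by omega) (by omega))
  · rw [topple_of_notMem hiA, Finset.mem_insert, not_or] at hyA hzA
    exact hyz.ne (huniq y hy z hz hyA.2 hzA.2)

/-- With at most one hole, a grain fills the old hole if there is one, either directly or as an end
of the avalanche. Hence a hole at `z` is the fresh one, which determines where the grain fell. -/
lemma eq_mirror_of_notMem_addGrain {N : ℕ} {i z : ℤ} (hi : i ∈ box N) (hz : z ∈ box N)
    {A : Box N} (hA : ¬ TwoHoles A) (h : z ∉ (addGrain N N i A : Finset ℤ)) :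
    i = mirror A z := by
  simp only [addGrain_self hi, coe_trunc, Finset.mem_inter, hz, and_true] at h
  by_cases hiA : i ∈ (A : Finset ℤ)
  · obtain ⟨lo, hi', h1, h2, hb⟩ := exists_isBlock hiA
    rw [hb.topple_eq h1 h2] at h
    simp only [Finset.mem_insert, Finset.mem_erase, not_or, not_and] at h
    by_cases hzr : z = lo + hi' - i
    · rw [hb.mirror_eq (by omega) (by omega)]; omega
    · exfalso
      have hzA := h.2.2 hzr
      have hlo : lo ∉ box N := fun hl => by
        rcases lt_or_gt_of_ne h.2.1 with hlt | hlt
        · exact hA ⟨z, hz, lo, hl, hzA, hb.lo_notMem, hlt⟩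
        · exact hA ⟨lo, hl, z, hz, hb.lo_notMem, hzA, hlt⟩
      have hhi : hi' ∉ box N := fun hl => by
        rcases lt_or_gt_of_ne h.1 with hlt | hlt
        · exact hA ⟨z, hz, hi', hl, hzA, hb.hi_notMem, hlt⟩
        · exact hA ⟨hi', hl, z, hz, hb.hi_notMem, hzA, hlt⟩
      rw [Finset.mem_Icc] at hlo hhi hz hi
      exact hzA (hb.mem z (by omega) (by omega))
  · exfalso
    rw [topple_of_notMem hiA, Finset.mem_insert, not_or] at h
    rcases lt_or_gt_of_ne h.1 with hlt | hlt
    · exact hA ⟨z, hz, i, hi, h.2, hiA, hlt⟩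
    · exact hA ⟨i, hi, z, hz, hiA, h.2, hlt⟩

/-- At most one of the `2N+1` equally likely grain positions leaves a hole at `z`; the exponential
is the probability that no grain has fallen yet. -/
lemma boxFlow_hole_le_of_not_twoHoles {N : ℕ} {z : ℤ} (hz : z ∈ box N) {A : Box N}
    (hA : ¬ TwoHoles A) {t : ℝ} (ht : 0 ≤ t) :
    boxFlow N N t (fun B => if z ∈ (B : Finset ℤ) then 0 else 1) A ≤
      1 / (2 * N + 1) + Real.exp (-((2 * N + 1) * t)) := by
  set f : Box N → ℝ := fun B => if z ∈ (B : Finset ℤ) then 0 else 1 with hf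
  have hcard : ((box N).card : ℝ) = 2 * N + 1 := by rw [card_box]; push_cast; rfl
  have hN : (0 : ℝ) < 2 * N + 1 := by positivity
  have hsum : ∀ B : Box N, ¬ TwoHoles B → ∑ i ∈ box N, f (addGrain N N i B) ≤ 1 := by
    intro B hB
    calc ∑ i ∈ box N, f (addGrain N N i B) ≤ ∑ i ∈ box N, if i = mirror B z then (1 : ℝ) else 0 := by
          refine Finset.sum_le_sum fun i hi => ?_
          simp only [hf]
          split_ifs with h1 h2 h2
          · exact zero_le_one
          · exact le_rfl
          · exact le_rfl
          · exact absurd (eq_mirror_of_notMem_addGrain hi hz hB h1) h2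
      _ ≤ 1 := by
          rw [Finset.sum_ite_eq']; split_ifs <;> simp
  -- After subtracting `1 / (2N+1)` the jump sum is nonpositive, so the centred indicator decays at
  -- the full rate `(box N).card`.
  have h := flow_le_of_sumComp_le (J := box N) (φ := addGrain N N) (I := fun B => ¬ TwoHoles B)
    (fun i hi B hB => not_twoHoles_addGrain hi hB)
    (g := f - fun _ => (1 / (2 * N + 1) : ℝ)) (c := (box N).card) le_rfl (fun B hB => by
      have := hsum B hB
      simp only [Pi.sub_apply, Finset.sum_sub_distrib, Finset.sum_const, nsmul_eq_mul, hcard]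
      rw [mul_one_div_cancel hN.ne']
      linarith) ht hA
  rw [map_sub, Pi.sub_apply, flow_const, hcard] at h
  have h1 : (f - fun _ : Box N => (1 / (2 * N + 1) : ℝ)) A ≤ 1 := by
    have : f A ≤ 1 := by simp only [hf]; split_ifs <;> simp
    have : 0 ≤ 1 / (2 * N + 1 : ℝ) := by positivity
    simp only [Pi.sub_apply]; linarith
  have h2 := mul_le_mul_of_nonneg_left h1 (Real.exp_nonneg (-((2 * N + 1) * t)))
  rw [boxFlow]
  linarith

lemma boxFlow_hole_le {N : ℕ} {z : ℤ} (hz : z ∈ box N) {t : ℝ} (ht : 7 ≤ t) :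
    boxFlow N N t (fun B => if z ∈ (B : Finset ℤ) then 0 else 1) (trunc N ∅) ≤
      (2 * N + 1) * Real.exp (-(N / 2)) + (1 / (2 * N + 1) + Real.exp (-(2 * N + 1))) := by
  classical
  set δ : ℝ := 1 / (2 * N + 1) + Real.exp (-(2 * N + 1)) with hδ
  have hle : ∀ A : Box N, boxFlow N N 1 (fun B => if z ∈ (B : Finset ℤ) then 0 else 1) A ≤
      ((fun A : Box N => if TwoHoles A then (1 : ℝ) else 0) + fun _ : Box N => δ) A := by
    intro A
    simp only [Pi.add_apply]
    split_ifs with h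
    · have h1 : boxFlow N N 1 (fun B => if z ∈ (B : Finset ℤ) then 0 else 1) A ≤ 1 := by
        have := flow_mono (J := box N) (φ := addGrain N N) (g := fun _ => 1)
          (f := fun B => if z ∈ (B : Finset ℤ) then 0 else 1)
          (fun B => by split_ifs <;> simp) zero_le_one A
        rwa [flow_const] at this
      have h2 : 0 ≤ δ := by positivity
      linarith
    · have := boxFlow_hole_le_of_not_twoHoles hz h zero_le_one
      rwa [mul_one, ← hδ, ← zero_add δ] at this
  -- At least six units of time bring the number of holes down to one or none, and the last unit
  -- spreads a remaining hole over the box.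
  have e : t = (t - 1) + 1 := by ring
  rw [e, boxFlow, flow_add]
  refine (flow_mono hle (by linarith) _).trans ?_
  rw [map_add, Pi.add_apply, flow_const]
  gcongr
  exact boxFlow_twoHoles_le N (by linarith)

/-! ### The full configuration in infinite volume -/

lemma boxExp_ge {N : ℕ} {z : ℤ} (hz : z ∈ box N) {t : ℝ} (ht : 7 ≤ t) (η : Config) :
    1 - ((2 * N + 1) * Real.exp (-(N / 2)) + (1 / (2 * N + 1) + Real.exp (-(2 * N + 1)))) ≤
      boxExp N t ((upSet {z}).indicator fun _ => (1 : ℝ)) η := by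
  have h1 : (1 : ℝ) - boxFlow N N t (fun B => if z ∈ (B : Finset ℤ) then 0 else 1) (trunc N ∅) =
      boxFlow N N t (fun B => if z ∈ (B : Finset ℤ) then 1 else 0) (trunc N ∅) := by
    have hc := boxFlow_const N N t 1 (trunc N ∅)
    have e : (fun _ : Box N => (1 : ℝ)) = (fun B : Box N => if z ∈ (B : Finset ℤ) then 1 else 0) +
        fun B : Box N => if z ∈ (B : Finset ℤ) then 0 else 1 := by
      ext B
      simp only [Pi.add_apply]
      split_ifs <;> simp
    rw [e, map_add, Pi.add_apply] at hc
    linarith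
  refine (sub_le_sub_left (boxFlow_hole_le hz ht) 1).trans ?_
  rw [h1]
  refine boxFlow_le_boxFlow le_rfl le_rfl le_rfl le_rfl (fun A B hAB => ?_) (by linarith) (by simp)
  have e : (upSet {z}).indicator (fun _ => (1 : ℝ)) (ofFinset B) =
      if z ∈ (B : Finset ℤ) then 1 else 0 := by
    simp [Set.indicator, upSet, ofFinset_apply_eq_two]
  rw [e]
  split_ifs with h2 h3 h3
  · exact le_rfl
  · exact absurd (hAB h2) h3
  · exact zero_le_one
  · exact le_rfl

/-- From time seven on, the sandpile process is at the full configuration. -/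
lemma transKernel_eq_dirac {t : ℝ≥0} (ht : 7 ≤ t) (η : Config) :
    transKernel t η = Measure.dirac allTwo := by
  have ht' : (7 : ℝ) ≤ t := by exact_mod_cast ht
  have hz : ∀ z : ℤ, ∀ᵐ ω ∂(transKernel t η), (ω z : ℕ) = 2 := by
    intro z
    have hlim := tendsto_boxExp t η (upSet_indicator_continuous {z}) (upSet_indicator_mono {z})
    have hlow : Tendsto (fun N : ℕ => 1 - ((2 * N + 1) * Real.exp (-(N / 2)) +
        (1 / (2 * N + 1) + Real.exp (-(2 * N + 1 : ℝ))))) atTop (𝓝 (1 - (0 + (0 + 0)))) := by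
      have hN : Tendsto (fun N : ℕ => (N : ℝ)) atTop atTop := tendsto_natCast_atTop_atTop
      have h2N : Tendsto (fun N : ℕ => (2 * N + 1 : ℝ)) atTop atTop :=
        tendsto_atTop_add_const_right _ _ (hN.const_mul_atTop two_pos)
      -- Used at `x = N / 2`, where `4 * x + 1 = 2 * N + 1`.
      have h3 : Tendsto (fun x : ℝ => (4 * x + 1) * Real.exp (-x)) atTop (𝓝 0) := by
        have ha := (Real.tendsto_pow_mul_exp_neg_atTop_nhds_zero 1).const_mul 4
        have hb := (Real.tendsto_pow_mul_exp_neg_atTop_nhds_zero 0)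
        have := ha.add hb
        simp only [pow_one, pow_zero, one_mul, mul_zero, add_zero] at this
        exact this.congr fun x => by ring
      have h4 := h3.comp (hN.atTop_div_const (two_pos (α := ℝ)))
      refine tendsto_const_nhds.sub (Tendsto.add (h4.congr fun N => ?_) (Tendsto.add ?_ ?_))
      · simp only [Function.comp]; ring_nf
      · exact tendsto_const_nhds.div_atTop h2N
      · exact Real.tendsto_exp_neg_atTop_nhds_zero.comp h2N
    have h1 : (1 : ℝ) ≤ ∫ ω, (upSet {z}).indicator (fun _ => (1 : ℝ)) ω ∂(limitLaw t η) := by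
      rw [add_zero, add_zero, sub_zero] at hlow
      refine le_of_tendsto_of_tendsto hlow hlim ?_
      filter_upwards [eventually_ge_atTop z.natAbs] with N hN
      exact boxExp_ge (by rw [Finset.mem_Icc]; omega) ht' η
    erw [integral_indicator_one (measurableSet_upSet {z})] at h1
    have h2 : limitLaw t η (upSet {z}) = 1 := by
      refine le_antisymm prob_le_one ?_
      rw [← ofReal_measureReal, ENNReal.one_le_ofReal]
      exact h1
    have h3 := (prob_compl_eq_zero_iff (measurableSet_upSet {z})).2 h2
    rw [ae_iff]
    refine (measure_mono ?_).trans_eq h3 |>.antisymm zero_le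
    intro ω hω
    simpa [upSet] using hω
  have hall : ∀ᵐ ω ∂(transKernel t η), ω = allTwo := by
    filter_upwards [ae_all_iff.2 hz] with ω hω
    ext z
    exact hω z
  have h : (id : Config → Config) =ᵐ[transKernel t η] fun _ => allTwo := hall
  rw [← Measure.map_id (μ := transKernel t η), Measure.map_congr h,
    Measure.map_const, measure_univ, one_smul]

/-! ### Kolmogorov extension for two-point spaces -/

/-- A projective family of probability measures on finite products of the two-point space has a
projective limit. -/
lemma exists_isProjectiveLimit {Z : Type*} {P : ∀ I : Finset Z, Measure (I → Height)}
    (hP : IsProjectiveMeasureFamily (α := fun _ : Z => Height) P) :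
    ∃ μ : Measure (Z → Height), IsProjectiveLimit (α := fun _ : Z => Height) μ P := by
  let m := projectiveFamilyContent hP
  -- Cylinders are clopen in a compact space, so a countable cover of a cylinder by cylinders has a
  -- finite subcover, and finite additivity already gives countable subadditivity.
  have hclopen : ∀ s ∈ measurableCylinders (fun _ : Z => Height), IsClopen s := by
    intro s hs
    obtain ⟨I, S, -, rfl⟩ := (mem_measurableCylinders s).1 hs
    exact (isClopen_discrete S).preimage (Finset.continuous_restrict I)
  have hsub : m.IsSigmaSubadditive := by
    intro f hf hU
    obtain ⟨t, ht⟩ := (hclopen _ hU).isClosed.isCompact.elim_finite_subcover f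
      (fun i => (hclopen _ (hf i)).isOpen) subset_rfl
    have hEq : ⋃ i, f i = ⋃ i ∈ t, f i :=
      ht.antisymm (Set.iUnion₂_subset fun i _ => Set.subset_iUnion f i)
    rw [hEq]
    exact (addContent_biUnion_le isSetRing_measurableCylinders fun i _ => hf i).trans
      (ENNReal.sum_le_tsum t)
  refine ⟨m.measure isSetSemiring_measurableCylinders generateFrom_measurableCylinders.ge hsub,
    fun I => ?_⟩
  ext S hS
  rw [Measure.map_apply (Finset.measurable_restrict I) hS]
  have hmem : cylinder I S ∈ measurableCylinders (fun _ : Z => Height) :=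
    (mem_measurableCylinders _).2 ⟨I, S, hS, rfl⟩
  exact (m.measure_eq isSetSemiring_measurableCylinders generateFrom_measurableCylinders.symm hsub
    hmem).trans (projectiveFamilyContent_cylinder hP hS)

/-! ### Finite-dimensional laws of the process -/

/-- The restriction of a path to finitely many times. -/
abbrev restr (J : Finset ℝ≥0) (ω : PathSpace) : J → Config :=
  J.restrict (π := fun _ : ℝ≥0 => Config) ω

lemma measurable_restr (J : Finset ℝ≥0) : Measurable (restr J) := Finset.measurable_restrict J

lemma measurable_eval (t : ℝ≥0) : Measurable fun ω : PathSpace => ω t := measurable_pi_apply t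

/-- The events depending on the times in `J` only. -/
abbrev cylSigma (J : Finset ℝ≥0) : MeasurableSpace PathSpace :=
  MeasurableSpace.comap (restr J) inferInstance

lemma cylSigma_le (J : Finset ℝ≥0) : cylSigma J ≤ MeasurableSpace.pi :=
  (measurable_restr J).comap_le

lemma cylSigma_mono {J J' : Finset ℝ≥0} (h : J ⊆ J') : cylSigma J ≤ cylSigma J' := by
  have : cylSigma J = MeasurableSpace.comap (restr J')
      (MeasurableSpace.comap (Finset.restrict₂ (π := fun _ : ℝ≥0 => Config) h) inferInstance) := by
    rw [MeasurableSpace.comap_comp]; rfl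
  rw [this]
  exact MeasurableSpace.comap_mono (Finset.measurable_restrict₂ h).comap_le

/-- At the times in `J`, the law `ν` is that of the Markov process with kernels `transKernel`
started from `η`. -/
structure IsMarkovOn (J : Finset ℝ≥0) (η : Config) (ν : Measure PathSpace) : Prop where
  initial : ν.map (fun ω => ω 0) = Measure.dirac η
  markov : ∀ s ∈ J, ∀ t ∈ J, s < t → ∀ A, MeasurableSet[cylSigma (J.filter (· ≤ s))] A →
    ∀ B, MeasurableSet B → ν (A ∩ {ω | ω t ∈ B}) = ∫⁻ ω in A, transKernel (t - s) (ω s) B ∂ν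

lemma IsMarkovOn.mono {J J' : Finset ℝ≥0} (h : J ⊆ J') {η : Config} {ν : Measure PathSpace}
    (hν : IsMarkovOn J' η ν) : IsMarkovOn J η ν :=
  ⟨hν.initial, fun s hs t ht hst A hA B hB => hν.markov s (h hs) t (h ht) hst A
    (cylSigma_mono (Finset.filter_subset_filter _ h) A hA) B hB⟩

lemma map_restr_mono {J J' : Finset ℝ≥0} (h : J ⊆ J') {ν ν' : Measure PathSpace}
    (hν : ν.map (restr J') = ν'.map (restr J')) : ν.map (restr J) = ν'.map (restr J) := by
  have e : ∀ μ : Measure PathSpace, μ.map (restr J) =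
      (μ.map (restr J')).map (Finset.restrict₂ (π := fun _ : ℝ≥0 => Config) h) := fun μ =>
    (Measure.map_map (μ := μ) (f := restr J')
      (g := Finset.restrict₂ (π := fun _ : ℝ≥0 => Config) h) (Finset.measurable_restrict₂ h)
      (measurable_restr J')).symm
  rw [e, hν, ← e]

lemma measure_eq_of_map_restr {J : Finset ℝ≥0} {ν ν' : Measure PathSpace}
    (hν : ν.map (restr J) = ν'.map (restr J)) {A : Set PathSpace}
    (hA : MeasurableSet[cylSigma J] A) : ν A = ν' A := by
  obtain ⟨S, hS, rfl⟩ := hA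
  rw [← Measure.map_apply (measurable_restr J) hS, hν, Measure.map_apply (measurable_restr J) hS]

lemma setLIntegral_eq_of_map_restr {J : Finset ℝ≥0} {ν ν' : Measure PathSpace}
    (hν : ν.map (restr J) = ν'.map (restr J)) {A : Set PathSpace}
    (hA : MeasurableSet[cylSigma J] A) {s : ℝ≥0} (hs : s ∈ J) {f : Config → ℝ≥0∞}
    (hf : Measurable f) : ∫⁻ ω in A, f (ω s) ∂ν = ∫⁻ ω in A, f (ω s) ∂ν' := by
  obtain ⟨S, hS, rfl⟩ := hA
  have hg : Measurable fun x : J → Config => f (x ⟨s, hs⟩) := hf.comp (measurable_pi_apply _)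
  have h1 := setLIntegral_map (μ := ν) hS hg (measurable_restr J)
  have h2 := setLIntegral_map (μ := ν') hS hg (measurable_restr J)
  rw [hν, h2] at h1
  exact h1.symm

lemma measurableSet_eval {J : Finset ℝ≥0} {t : ℝ≥0} (ht : t ∈ J) {B : Set Config}
    (hB : MeasurableSet B) : MeasurableSet[cylSigma J] {ω : PathSpace | ω t ∈ B} :=
  ⟨{x | x ⟨t, ht⟩ ∈ B}, measurable_pi_apply _ hB, rfl⟩

lemma measurable_transKernel_apply (t : ℝ≥0) {B : Set Config} (hB : MeasurableSet B) :
    Measurable fun η => transKernel t η B := Kernel.measurable_coe _ hB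

lemma IsMarkovOn.congr {J : Finset ℝ≥0} (h0 : 0 ∈ J) {η : Config} {ν ν' : Measure PathSpace}
    (hν : ν.map (restr J) = ν'.map (restr J)) (h : IsMarkovOn J η ν) : IsMarkovOn J η ν' := by
  refine ⟨?_, fun s hs t ht hst A hA B hB => ?_⟩
  · rw [← h.initial]
    ext B hB
    rw [Measure.map_apply (measurable_eval 0) hB, Measure.map_apply (measurable_eval 0) hB]
    exact (measure_eq_of_map_restr hν (measurableSet_eval h0 hB)).symm
  · have hA' := cylSigma_mono (Finset.filter_subset (· ≤ s) J) A hA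
    rw [← measure_eq_of_map_restr hν (hA'.inter (measurableSet_eval ht hB)),
      h.markov s hs t ht hst A hA B hB]
    exact setLIntegral_eq_of_map_restr hν hA' hs (measurable_transKernel_apply _ hB)

lemma cylSigma_le_filter {J J' : Finset ℝ≥0} {s : ℝ≥0} (h : J' ⊆ J) (hs : ∀ r ∈ J', r ≤ s) :
    cylSigma J' ≤ cylSigma (J.filter (· ≤ s)) :=
  cylSigma_mono fun r hr => Finset.mem_filter.2 ⟨h hr, hs r hr⟩

/-- The finite-dimensional laws are determined by the Markov property. -/
lemma IsMarkovOn.map_restr_eq {J : Finset ℝ≥0} (h0 : 0 ∈ J) {η : Config}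
    {ν ν' : Measure PathSpace} [IsProbabilityMeasure ν] [IsProbabilityMeasure ν']
    (hν : IsMarkovOn J η ν) (hν' : IsMarkovOn J η ν') :
    ν.map (restr J) = ν'.map (restr J) := by
  induction J using Finset.induction_on_max with
  | empty => simp at h0
  | insert a J ha ih =>
    have hsub : J ⊆ insert a J := Finset.subset_insert a J
    -- The joint law with the last time `a` follows from the law on `J` by conditioning at the
    -- largest time of `J`. If `0 ∉ J`, then `a = 0`, `J` is empty, and the initial condition
    -- decides.
    have key : ∀ A, MeasurableSet[cylSigma J] A → ∀ B, MeasurableSet B →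
        ν (A ∩ {ω | ω a ∈ B}) = ν' (A ∩ {ω | ω a ∈ B}) := by
      intro A hA B hB
      by_cases h0J : 0 ∈ J
      · have hJ := ih h0J (hν.mono hsub) (hν'.mono hsub)
        have hne : J.Nonempty := ⟨0, h0J⟩
        have hm := J.max'_mem hne
        have hA' := cylSigma_le_filter (s := J.max' hne) hsub (fun r hr => J.le_max' r hr) A hA
        rw [hν.markov _ (hsub hm) a (Finset.mem_insert_self a J) (ha _ hm) A hA' B hB,
          hν'.markov _ (hsub hm) a (Finset.mem_insert_self a J) (ha _ hm) A hA' B hB]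
        exact setLIntegral_eq_of_map_restr hJ hA hm (measurable_transKernel_apply _ hB)
      · have ha0 : a = 0 := by
          rcases Finset.mem_insert.1 h0 with h | h
          · exact h.symm
          · exact absurd h h0J
        subst ha0
        have hJe : J = ∅ := Finset.eq_empty_of_forall_notMem fun r hr => not_lt_zero (ha r hr)
        subst hJe
        obtain ⟨S, hS, rfl⟩ := hA
        have h1 : ν {ω | ω 0 ∈ B} = ν' {ω | ω 0 ∈ B} := by
          have e1 := Measure.map_apply (μ := ν) (measurable_eval 0) hB
          have e2 := Measure.map_apply (μ := ν') (measurable_eval 0) hB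
          rw [hν.initial] at e1
          rw [hν'.initial] at e2
          exact e1.symm.trans e2
        rcases S.eq_empty_or_nonempty with rfl | ⟨x, hx⟩
        · simp
        · have : restr ∅ ⁻¹' S = Set.univ := by
            ext ω; simpa [Subsingleton.elim (restr ∅ ω) x] using hx
          rw [this, Set.univ_inter, h1]
    have hpair : ν.map (fun ω => (restr J ω, ω a)) = ν'.map (fun ω => (restr J ω, ω a)) := by
      have hmeas : Measurable fun ω : PathSpace => (restr J ω, ω a) :=
        (measurable_restr J).prodMk (measurable_eval a)
      have : IsProbabilityMeasure (ν.map fun ω => (restr J ω, ω a)) :=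
        Measure.isProbabilityMeasure_map hmeas.aemeasurable
      refine Measure.ext_prod fun {S B} hS hB => ?_
      rw [Measure.map_apply hmeas (hS.prod hB), Measure.map_apply hmeas (hS.prod hB)]
      exact key _ ⟨S, hS, rfl⟩ B hB
    classical
    let φ : (J → Config) × Config → (↥(insert a J) → Config) := fun p r =>
      if h : (r : ℝ≥0) ∈ J then p.1 ⟨r, h⟩ else p.2
    have hφ : Measurable φ := by
      refine measurable_pi_iff.2 fun r => ?_
      by_cases h : (r : ℝ≥0) ∈ J
      · simp only [φ, h, dif_pos]
        exact (measurable_pi_apply _).comp measurable_fst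
      · simp only [φ, h, dif_neg, not_false_eq_true]
        exact measurable_snd
    have e : restr (insert a J) = φ ∘ fun ω => (restr J ω, ω a) := by
      ext1 ω; ext1 r
      simp only [φ, Function.comp]
      split_ifs with h
      · rfl
      · have : (r : ℝ≥0) = a := by
          rcases Finset.mem_insert.1 r.2 with h' | h'
          · exact h'
          · exact absurd h' h
        change ω r = ω a
        rw [this]
    have hmeas : Measurable fun ω : PathSpace => (restr J ω, ω a) :=
      (measurable_restr J).prodMk (measurable_eval a)
    rw [e, ← Measure.map_map hφ hmeas, hpair, Measure.map_map hφ hmeas]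

lemma measurable_update_path (a : ℝ≥0) :
    Measurable fun q : PathSpace × Config => Function.update q.1 a q.2 := by
  refine measurable_pi_iff.2 fun r => ?_
  by_cases h : r = a
  · subst h; simpa using measurable_snd
  · simp only [Function.update_of_ne h]
    exact (measurable_eval r).comp measurable_fst

/-- Extend the laws `κ` by the position at time `a`, chosen according to the position at
time `m`. -/
def extendKernel (κ : Kernel Config PathSpace) (m a : ℝ≥0) : Kernel Config PathSpace :=
  (κ ⊗ₖ ((transKernel (a - m)).comap (fun p : Config × PathSpace => p.2 m)
    ((measurable_eval m).comp measurable_snd))).map fun q => Function.update q.1 a q.2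

instance (κ : Kernel Config PathSpace) [IsMarkovKernel κ] (m a : ℝ≥0) :
    IsMarkovKernel (extendKernel κ m a) :=
  Kernel.IsMarkovKernel.map _ (measurable_update_path a)

lemma extendKernel_apply (κ : Kernel Config PathSpace) [IsMarkovKernel κ] (m : ℝ≥0) {a : ℝ≥0}
    {J : Finset ℝ≥0} (ha : a ∉ J) (η : Config) {A : Set PathSpace}
    (hA : MeasurableSet[cylSigma J] A) {B : Set Config} (hB : MeasurableSet B) :
    extendKernel κ m a η (A ∩ {ω | ω a ∈ B}) =
      ∫⁻ ω in A, transKernel (a - m) (ω m) B ∂(κ η) := by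
  have hA' := cylSigma_le J A hA
  have hAB : MeasurableSet (A ∩ {ω : PathSpace | ω a ∈ B}) := hA'.inter (measurable_eval a hB)
  rw [extendKernel, Kernel.map_apply' _ (measurable_update_path a) _ hAB,
    Kernel.compProd_apply (measurable_update_path a hAB), ← lintegral_indicator hA']
  refine lintegral_congr fun ω => ?_
  obtain ⟨S, hS, rfl⟩ := hA
  have hr : ∀ ζ, restr J (Function.update ω a ζ) = restr J ω := by
    intro ζ
    ext1 r
    have hne : (r : ℝ≥0) ≠ a := fun h => ha (h ▸ r.2)
    exact Function.update_of_ne hne _ _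
  simp only [Kernel.comap_apply]
  by_cases hω : ω ∈ restr J ⁻¹' S
  · rw [Set.indicator_of_mem hω]
    congr 1
    ext ζ
    simp only [Set.mem_preimage, Set.mem_inter_iff, hr, Set.mem_ofPred_eq, Function.update_self]
    exact and_iff_right hω
  · rw [Set.indicator_of_notMem hω]
    convert measure_empty (μ := transKernel (a - m) (ω m))
    ext ζ
    simp only [Set.mem_preimage, Set.mem_inter_iff, hr, Set.mem_empty_iff_false, iff_false, not_and]
    exact fun h => absurd h hω

lemma extendKernel_map_restr (κ : Kernel Config PathSpace) [IsMarkovKernel κ] (m : ℝ≥0)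
    {a : ℝ≥0} {J : Finset ℝ≥0} (ha : a ∉ J) (η : Config) :
    (κ η).map (restr J) = (extendKernel κ m a η).map (restr J) := by
  ext S hS
  rw [Measure.map_apply (measurable_restr J) hS, Measure.map_apply (measurable_restr J) hS]
  have := extendKernel_apply κ m ha η (A := restr J ⁻¹' S) ⟨S, hS, rfl⟩ MeasurableSet.univ
  simp only [Set.mem_univ, Set.ofPred_true, Set.inter_univ, measure_univ, lintegral_one,
    Measure.restrict_apply_univ] at this
  exact this.symm

/-- The Markov property for functions. -/
lemma IsMarkovOn.setLIntegral {J : Finset ℝ≥0} {η : Config} {ν : Measure PathSpace}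
    (h : IsMarkovOn J η ν) {s t : ℝ≥0} (hs : s ∈ J) (ht : t ∈ J) (hst : s < t)
    {A : Set PathSpace} (hA : MeasurableSet[cylSigma (J.filter (· ≤ s))] A) {f : Config → ℝ≥0∞}
    (hf : Measurable f) :
    ∫⁻ ω in A, f (ω t) ∂ν = ∫⁻ ω in A, ∫⁻ ζ, f ζ ∂(transKernel (t - s) (ω s)) ∂ν := by
  have hA' := cylSigma_le _ A hA
  have hκ : Measurable fun ω : PathSpace => transKernel (t - s) (ω s) :=
    (Kernel.measurable _).comp (measurable_eval s)
  have e : (ν.restrict A).map (fun ω => ω t) =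
      (ν.restrict A).bind fun ω => transKernel (t - s) (ω s) := by
    ext B hB
    rw [Measure.map_apply (measurable_eval t) hB, Measure.bind_apply hB hκ.aemeasurable,
      Measure.restrict_apply (measurable_eval t hB), Set.inter_comm]
    exact h.markov s hs t ht hst A hA B hB
  rw [← lintegral_map hf (measurable_eval t), e, Measure.lintegral_bind hκ.aemeasurable
    hf.aemeasurable]

/-- The transition from `m` to `a` is right by construction, transitions within `J` are untouched,
and a transition from `s < m` to `a` passes through `m` by Chapman-Kolmogorov. -/
lemma isMarkovOn_extendKernel {κ : Kernel Config PathSpace} [IsMarkovKernel κ] {m a : ℝ≥0}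
    {J : Finset ℝ≥0} (h0 : 0 ∈ J) (hm : m ∈ J) (hmax : ∀ r ∈ J, r ≤ m) (ha : ∀ r ∈ J, r < a)
    {η : Config} (h : IsMarkovOn J η (κ η)) :
    IsMarkovOn (insert a J) η (extendKernel κ m a η) := by
  have haJ : a ∉ J := fun h => lt_irrefl a (ha a h)
  have hmap := extendKernel_map_restr κ m haJ η
  have h' := h.congr h0 hmap
  refine ⟨h'.initial, fun s hs t ht hst A hA B hB => ?_⟩
  have hsJ : s ∈ J := by
    rcases Finset.mem_insert.1 hs with rfl | hs
    · rcases Finset.mem_insert.1 ht with rfl | ht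
      · exact absurd hst (lt_irrefl _)
      · exact absurd (ha t ht) (not_lt.2 hst.le)
    · exact hs
  rw [Finset.filter_insert, if_neg (not_le.2 (ha s hsJ))] at hA
  rcases Finset.mem_insert.1 ht with rfl | htJ
  · have hAJ := cylSigma_mono (Finset.filter_subset (· ≤ s) J) A hA
    rw [extendKernel_apply κ m haJ η hAJ hB, ← setLIntegral_eq_of_map_restr hmap hAJ hsJ
      (measurable_transKernel_apply _ hB)]
    rcases (hmax s hsJ).eq_or_lt with rfl | hsm
    · rfl
    · rw [h.setLIntegral hsJ hm hsm hA (measurable_transKernel_apply _ hB)]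
      refine lintegral_congr fun ω => ?_
      have e : t - s = (m - s) + (t - m) := by
        rw [add_comm, tsub_add_tsub_cancel (ha m hm).le hsm.le]
      rw [e, transKernel_add, Kernel.comp_apply' _ _ _ hB]
  · exact h'.markov s hsJ t htJ hst A hA B hB

lemma exists_isMarkovOn (J : Finset ℝ≥0) (h0 : 0 ∈ J) :
    ∃ κ : Kernel Config PathSpace, IsMarkovKernel κ ∧ ∀ η, IsMarkovOn J η (κ η) := by
  induction J using Finset.induction_on_max with
  | empty => simp at h0
  | insert a J ha ih =>
    by_cases h0J : 0 ∈ J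
    · obtain ⟨κ, hκ, h⟩ := ih h0J
      have hne : J.Nonempty := ⟨0, h0J⟩
      exact ⟨extendKernel κ (J.max' hne) a, inferInstance, fun η =>
        isMarkovOn_extendKernel h0J (J.max'_mem hne) (fun r hr => J.le_max' r hr) ha (h η)⟩
    · have ha0 : a = 0 := by
        rcases Finset.mem_insert.1 h0 with h | h
        · exact h.symm
        · exact absurd h h0J
      subst ha0
      have hJe : J = ∅ := Finset.eq_empty_of_forall_notMem fun r hr => not_lt_zero (ha r hr)
      subst hJe
      have hc : Measurable fun (η : Config) (_ : ℝ≥0) => η :=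
        measurable_pi_iff.2 fun _ => measurable_id
      refine ⟨Kernel.deterministic _ hc, inferInstance, fun η => ⟨?_, ?_⟩⟩
      · rw [Kernel.deterministic_apply]
        exact Measure.map_dirac' (measurable_eval 0) _
      · intro s hs t ht hst
        simp only [Finset.mem_insert, Finset.notMem_empty, or_false] at hs ht
        exact absurd hst (by rw [hs, ht]; exact lt_irrefl _)

/-! ### The sandpile process -/

/-- Evaluation of a path at finitely many space-time points. -/
def evalAt (I : Finset (ℝ≥0 × ℤ)) (ω : PathSpace) : I → Height := fun z => ω z.1.1 z.1.2

lemma measurable_evalAt (I : Finset (ℝ≥0 × ℤ)) : Measurable (evalAt I) :=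
  measurable_pi_iff.2 fun z => (measurable_pi_apply z.1.2).comp (measurable_eval z.1.1)

lemma map_evalAt_eq {J : Finset ℝ≥0} {I : Finset (ℝ≥0 × ℤ)} (h : ∀ z ∈ I, z.1 ∈ J)
    {ν ν' : Measure PathSpace} (hν : ν.map (restr J) = ν'.map (restr J)) :
    ν.map (evalAt I) = ν'.map (evalAt I) := by
  let g : (J → Config) → (I → Height) := fun x z => x ⟨z.1.1, h z.1 z.2⟩ z.1.2
  have hg : Measurable g :=
    measurable_pi_iff.2 fun z => (measurable_pi_apply z.1.2).comp (measurable_pi_apply _)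
  have e : ∀ μ : Measure PathSpace, μ.map (evalAt I) = (μ.map (restr J)).map g := fun μ =>
    (Measure.map_map (μ := μ) (f := restr J) (g := g) hg (measurable_restr J)).symm
  rw [e, hν, ← e]

/-- Carries identities from finitely many space-time points, where the extension theorem works with
two-point factors, to whole configurations at finitely many times. -/
lemma map_restr_eq_of_evalAt {J : Finset ℝ≥0} {ν ν' : Measure PathSpace} [IsProbabilityMeasure ν]
    [IsProbabilityMeasure ν']
    (h : ∀ I : Finset (ℝ≥0 × ℤ), (∀ z ∈ I, z.1 ∈ J) → ν.map (evalAt I) = ν'.map (evalAt I)) :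
    ν.map (restr J) = ν'.map (restr J) := by
  classical
  have hp : IsProbabilityMeasure (ν.map (restr J)) :=
    Measure.isProbabilityMeasure_map (measurable_restr J).aemeasurable
  have hp' : IsProbabilityMeasure (ν'.map (restr J)) :=
    Measure.isProbabilityMeasure_map (measurable_restr J).aemeasurable
  let e := MeasurableEquiv.curry J ℤ Height
  refine e.symm.map_measurableEquiv_injective ?_
  have hq : IsProbabilityMeasure ((ν.map (restr J)).map e.symm) :=
    Measure.isProbabilityMeasure_map e.symm.measurable.aemeasurable
  have hq' : IsProbabilityMeasure ((ν'.map (restr J)).map e.symm) :=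
    Measure.isProbabilityMeasure_map e.symm.measurable.aemeasurable
  refine ext_of_generate_finite _ (generateFrom_upSet (J × ℤ)) (isPiSystem_upSet _) ?_ (by simp)
  rintro _ ⟨F, rfl⟩
  let I : Finset (ℝ≥0 × ℤ) := F.image fun p => (p.1.1, p.2)
  have hI : ∀ z ∈ I, z.1 ∈ J := by
    intro z hz
    obtain ⟨p, -, rfl⟩ := Finset.mem_image.1 hz
    exact p.1.2
  have hS : MeasurableSet {x : I → Height | ∀ z, (x z : ℕ) = 2} :=
    (Set.to_countable _).measurableSet
  have hpre : restr J ⁻¹' (e.symm ⁻¹' upSet F) = evalAt I ⁻¹' {x | ∀ z, (x z : ℕ) = 2} := by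
    ext ω
    simp only [Set.mem_preimage, upSet, Set.mem_ofPred_eq]
    constructor
    · rintro hω ⟨z, hz⟩
      obtain ⟨p, hp, rfl⟩ := Finset.mem_image.1 hz
      exact hω p hp
    · intro hω p hp
      exact hω ⟨_, Finset.mem_image_of_mem _ hp⟩
  rw [Measure.map_apply e.symm.measurable (measurableSet_upSet F),
    Measure.map_apply e.symm.measurable (measurableSet_upSet F),
    Measure.map_apply (measurable_restr J) (e.symm.measurable (measurableSet_upSet F)),
    Measure.map_apply (measurable_restr J) (e.symm.measurable (measurableSet_upSet F)), hpre,
    ← Measure.map_apply (measurable_evalAt I) hS, ← Measure.map_apply (measurable_evalAt I) hS,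
    h I hI]

/-- The kernel of the laws of the process at the times in `insert 0 J`. -/
def markovKernel (J : Finset ℝ≥0) : Kernel Config PathSpace :=
  (exists_isMarkovOn (insert 0 J) (Finset.mem_insert_self 0 J)).choose

instance (J : Finset ℝ≥0) : IsMarkovKernel (markovKernel J) :=
  (exists_isMarkovOn (insert 0 J) (Finset.mem_insert_self 0 J)).choose_spec.1

lemma isMarkovOn_markovKernel (J : Finset ℝ≥0) (η : Config) :
    IsMarkovOn (insert 0 J) η (markovKernel J η) :=
  (exists_isMarkovOn (insert 0 J) (Finset.mem_insert_self 0 J)).choose_spec.2 η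

lemma markovKernel_map_restr {J J' : Finset ℝ≥0} (h : J ⊆ J') (η : Config) :
    (markovKernel J η).map (restr (insert 0 J)) = (markovKernel J' η).map (restr (insert 0 J)) :=
  (isMarkovOn_markovKernel J η).map_restr_eq (Finset.mem_insert_self 0 J)
    ((isMarkovOn_markovKernel J' η).mono (Finset.insert_subset_insert 0 h))

/-- The laws of the process at finitely many space-time points. -/
def pointLaw (η : Config) (I : Finset (ℝ≥0 × ℤ)) : Measure (I → Height) :=
  (markovKernel (I.image Prod.fst) η).map (evalAt I)

lemma pointLaw_eq {J : Finset ℝ≥0} {I : Finset (ℝ≥0 × ℤ)} (h : ∀ z ∈ I, z.1 ∈ J) (η : Config) :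
    pointLaw η I = (markovKernel J η).map (evalAt I) :=
  map_evalAt_eq (fun _ hz => Finset.mem_insert_of_mem (Finset.mem_image_of_mem _ hz))
    (markovKernel_map_restr (Finset.image_subset_iff.2 h) η)

instance (η : Config) (I : Finset (ℝ≥0 × ℤ)) : IsProbabilityMeasure (pointLaw η I) :=
  Measure.isProbabilityMeasure_map (measurable_evalAt I).aemeasurable

lemma isProjectiveMeasureFamily_pointLaw (η : Config) :
    IsProjectiveMeasureFamily (α := fun _ : ℝ≥0 × ℤ => Height) (pointLaw η) := by
  intro I I' h
  rw [pointLaw_eq (J := I.image Prod.fst)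
    (fun z hz => Finset.mem_image_of_mem _ (h hz)) η]
  exact (Measure.map_map (μ := markovKernel (I.image Prod.fst) η) (f := evalAt I)
    (g := Finset.restrict₂ (π := fun _ : ℝ≥0 × ℤ => Height) h) (Finset.measurable_restrict₂ h)
    (measurable_evalAt I)).symm

/-- The law of the space-time field of heights. -/
def fieldLaw (η : Config) : Measure (ℝ≥0 × ℤ → Height) :=
  (exists_isProjectiveLimit (isProjectiveMeasureFamily_pointLaw η)).choose

lemma isProjectiveLimit_fieldLaw (η : Config) :
    IsProjectiveLimit (α := fun _ : ℝ≥0 × ℤ => Height) (fieldLaw η) (pointLaw η) :=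
  (exists_isProjectiveLimit (isProjectiveMeasureFamily_pointLaw η)).choose_spec

instance (η : Config) : IsProbabilityMeasure (fieldLaw η) :=
  (isProjectiveLimit_fieldLaw η).isProbabilityMeasure

lemma measurable_fieldLaw : Measurable fieldLaw := by
  refine Measurable.measure_of_isPiSystem_of_isProbabilityMeasure (generateFrom_upSet _)
    (isPiSystem_upSet _) ?_
  rintro _ ⟨F, rfl⟩
  have hS : MeasurableSet {x : F → Height | ∀ z, (x z : ℕ) = 2} :=
    (Set.to_countable _).measurableSet
  have h : ∀ η, fieldLaw η (upSet F) = markovKernel (F.image Prod.fst) η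
      (evalAt F ⁻¹' {x | ∀ z, (x z : ℕ) = 2}) := by
    intro η
    rw [← Measure.map_apply (measurable_evalAt F) hS]
    have := (isProjectiveLimit_fieldLaw η).measure_cylinder F hS
    rw [pointLaw] at this
    rw [← this]
    congr 1
    ext ω
    simp [upSet, cylinder]
  simp only [h]
  exact Kernel.measurable_coe _ (measurable_evalAt F hS)

/-- The sandpile process. -/
def sandpileProcess : Kernel Config PathSpace :=
  (⟨fieldLaw, measurable_fieldLaw⟩ : Kernel Config (ℝ≥0 × ℤ → Height)).map
    (MeasurableEquiv.curry ℝ≥0 ℤ Height)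

instance : IsMarkovKernel sandpileProcess :=
  have : IsMarkovKernel (⟨fieldLaw, measurable_fieldLaw⟩ : Kernel Config (ℝ≥0 × ℤ → Height)) :=
    ⟨fun η => inferInstanceAs (IsProbabilityMeasure (fieldLaw η))⟩
  Kernel.IsMarkovKernel.map _ (MeasurableEquiv.measurable _)

lemma sandpileProcess_map_evalAt (η : Config) (I : Finset (ℝ≥0 × ℤ)) :
    (sandpileProcess η).map (evalAt I) = pointLaw η I := by
  rw [sandpileProcess, Kernel.map_apply _ (MeasurableEquiv.measurable _),
    Measure.map_map (measurable_evalAt I) (MeasurableEquiv.measurable _)]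
  exact isProjectiveLimit_fieldLaw η I

lemma isMarkovOn_sandpileProcess {J : Finset ℝ≥0} (h0 : 0 ∈ J) (η : Config) :
    IsMarkovOn J η (sandpileProcess η) := by
  have h : IsMarkovOn J η (markovKernel J η) :=
    (isMarkovOn_markovKernel J η).mono (Finset.subset_insert 0 J)
  refine h.congr h0 (map_restr_eq_of_evalAt fun I hI => ?_)
  rw [sandpileProcess_map_evalAt, pointLaw_eq hI]

/-! ### From finite-dimensional laws to the Markov property -/

section MarkovProperty

variable {η : Config} {ν : Measure PathSpace}

lemma map_eval_of_isMarkovOn (h : ∀ J : Finset ℝ≥0, 0 ∈ J → IsMarkovOn J η ν) (s : ℝ≥0) :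
    ν.map (fun ω => ω s) = transKernel s η := by
  rcases eq_zero_or_pos s with rfl | hs
  · rw [transKernel_zero, (h {0} (by simp)).initial]
  · ext B hB
    have hM := (h {0, s} (by simp)).markov 0 (by simp) s (by simp) hs Set.univ
      MeasurableSet.univ B hB
    rw [Set.univ_inter, Measure.restrict_univ, tsub_zero, ← lintegral_map
      (measurable_transKernel_apply s hB) (measurable_eval 0), (h {0} (by simp)).initial,
      lintegral_dirac' _ (measurable_transKernel_apply s hB)] at hM
    rw [Measure.map_apply (measurable_eval s) hB]
    exact hM

lemma past_le (t : ℝ≥0) : past t ≤ MeasurableSpace.pi :=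
  iSup₂_le fun r _ => (measurable_eval r).comap_le

lemma measurable_eval_past {r t : ℝ≥0} (h : r ≤ t) :
    Measurable[past t] fun ω : PathSpace => ω r :=
  measurable_iff_comap_le.2 (le_iSup₂_of_le r h le_rfl)

lemma cylSigma_le_past {J : Finset ℝ≥0} {t : ℝ≥0} (h : ∀ r ∈ J, r ≤ t) :
    cylSigma J ≤ past t := by
  rw [cylSigma, ← measurable_iff_comap_le]
  exact @measurable_pi_iff _ _ _ (past t) _ _ |>.2 fun r => measurable_eval_past (h r r.2)

lemma past_eq_generateFrom (t : ℝ≥0) : past t = MeasurableSpace.generateFrom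
    {A | ∃ J : Finset ℝ≥0, (∀ r ∈ J, r ≤ t) ∧ MeasurableSet[cylSigma J] A} := by
  refine le_antisymm (iSup₂_le fun r hr => ?_) (MeasurableSpace.generateFrom_le ?_)
  · rintro _ ⟨B, hB, rfl⟩
    exact MeasurableSpace.measurableSet_generateFrom
      ⟨{r}, by simpa using hr, measurableSet_eval (Finset.mem_singleton_self r) hB⟩
  · rintro A ⟨J, hJ, hA⟩
    exact cylSigma_le_past hJ A hA

lemma isPiSystem_past (t : ℝ≥0) : IsPiSystem
    {A | ∃ J : Finset ℝ≥0, (∀ r ∈ J, r ≤ t) ∧ MeasurableSet[cylSigma J] A} := by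
  rintro A ⟨J, hJ, hA⟩ B ⟨J', hJ', hB⟩ -
  refine ⟨J ∪ J', ?_, MeasurableSet.inter (cylSigma_mono Finset.subset_union_left A hA)
    (cylSigma_mono Finset.subset_union_right B hB)⟩
  intro r hr
  rcases Finset.mem_union.1 hr with hr | hr
  · exact hJ r hr
  · exact hJ' r hr

/-- As functions of `A` both sides are finite measures on `past t`. They agree on the π-system of
events depending on finitely many times up to `t`, which generates `past t`. -/
lemma markov_of_isMarkovOn [IsProbabilityMeasure ν]
    (h : ∀ J : Finset ℝ≥0, 0 ∈ J → IsMarkovOn J η ν) (s t : ℝ≥0)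
    {A : Set PathSpace} (hA : MeasurableSet[past t] A) {B : Set Config} (hB : MeasurableSet B) :
    ν (A ∩ {ω | ω (t + s) ∈ B}) = ∫⁻ ω in A, transKernel s (ω t) B ∂ν := by
  have hA' := past_le t A hA
  -- `IsMarkovOn` speaks of strictly increasing times only, so `s = 0` is treated through
  -- `transKernel_zero`.
  rcases eq_zero_or_pos s with rfl | hs
  · simp only [transKernel_zero, add_zero, Measure.dirac_apply' _ hB]
    have e := lintegral_indicator_one (μ := ν.restrict A) (measurable_eval t hB)
    rw [Measure.restrict_apply (measurable_eval t hB), Set.inter_comm] at e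
    exact e.symm
  · let f : PathSpace → ℝ≥0∞ := fun ω => transKernel s (ω t) B
    have hBm : MeasurableSet {ω : PathSpace | ω (t + s) ∈ B} := measurable_eval (t + s) hB
    have hfin : IsFiniteMeasure ((ν.restrict {ω | ω (t + s) ∈ B}).trim (past_le t)) :=
      isFiniteMeasure_trim _
    have key : ∀ A, (∃ J : Finset ℝ≥0, (∀ r ∈ J, r ≤ t) ∧ MeasurableSet[cylSigma J] A) →
        (ν.restrict {ω | ω (t + s) ∈ B}).trim (past_le t) A =
          (ν.withDensity f).trim (past_le t) A := by
      rintro A ⟨J, hJ, hA⟩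
      have hAp := cylSigma_le_past hJ A hA
      have hA' := past_le t A hAp
      rw [trim_measurableSet_eq _ hAp, trim_measurableSet_eq _ hAp, Measure.restrict_apply hA',
        withDensity_apply _ hA']
      have hM := (h (insert 0 (insert t (insert (t + s) J))) (by simp)).markov t (by simp) (t + s)
        (by simp) (lt_add_of_pos_right t hs) A
        (cylSigma_le_filter (fun r hr => by simp [hr]) hJ A hA) B hB
      rwa [add_tsub_cancel_left] at hM
    have hEq : (ν.restrict {ω | ω (t + s) ∈ B}).trim (past_le t) =
        (ν.withDensity f).trim (past_le t) :=
      @ext_of_generate_finite _ (past t) _ _ _ (past_eq_generateFrom t) (isPiSystem_past t) hfin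
        key (key _ ⟨∅, by simp, MeasurableSet.univ⟩)
    have := congrArg (fun μ => μ A) hEq
    rwa [trim_measurableSet_eq _ hA, trim_measurableSet_eq _ hA, Measure.restrict_apply hA',
        withDensity_apply _ hA'] at this

end MarkovProperty

lemma sandpileProcess_map_eval (η : Config) (s : ℝ≥0) :
    (sandpileProcess η).map (fun ω => ω s) = transKernel s η :=
  map_eval_of_isMarkovOn (fun _ h0 => isMarkovOn_sandpileProcess h0 η) s

lemma isSandpileProcess_sandpileProcess : IsSandpileProcess sandpileProcess where
  isMarkovKernel := inferInstance
  semigroup_eq t η f hf hm := by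
    obtain ⟨g, hg, hlim⟩ := exists_tendsto_semigroup t η hf hm
    refine ⟨g, hg, ?_⟩
    rwa [← sandpileProcess_map_eval, integral_map (measurable_eval t).aemeasurable
      hf.aestronglyMeasurable] at hlim
  markov η s t A B hA hB := by
    rw [markov_of_isMarkovOn (fun _ h0 => isMarkovOn_sandpileProcess h0 η) s t hA hB]
    refine lintegral_congr fun ω => ?_
    rw [← sandpileProcess_map_eval, Measure.map_apply (measurable_eval s) hB]
    rfl

/-! ### Uniqueness of the process and of its invariant measure -/

lemma IsSandpileProcess.map_eval {Q : Kernel Config PathSpace} (hQ : IsSandpileProcess Q)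
    (η : Config) (t : ℝ≥0) : (Q η).map (fun ω => ω t) = transKernel t η := by
  have := hQ.isMarkovKernel
  have hp : IsProbabilityMeasure ((Q η).map fun ω => ω t) :=
    Measure.isProbabilityMeasure_map (measurable_eval t).aemeasurable
  refine measure_ext_of_monotone fun f hf hm => ?_
  obtain ⟨g, hg, hlim⟩ := exists_tendsto_semigroup t η hf hm
  obtain ⟨g', hg', hlim'⟩ := hQ.semigroup_eq t η f hf hm
  have e : g' = g := funext fun n => tendsto_nhds_unique (hg' n) (hg n)
  rw [integral_map (measurable_eval t).aemeasurable hf.aestronglyMeasurable]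
  exact tendsto_nhds_unique (e ▸ hlim') hlim

lemma IsSandpileProcess.isMarkovOn {Q : Kernel Config PathSpace} (hQ : IsSandpileProcess Q)
    (η : Config) (J : Finset ℝ≥0) : IsMarkovOn J η (Q η) := by
  refine ⟨by rw [hQ.map_eval, transKernel_zero], fun s _ t _ hst A hA B hB => ?_⟩
  have hM := hQ.markov η (t - s) s A B
    (cylSigma_le_past (fun r hr => (Finset.mem_filter.1 hr).2) A hA) hB
  rw [add_tsub_cancel_of_le hst.le] at hM
  rw [hM]
  refine lintegral_congr fun ω => ?_
  rw [← hQ.map_eval, Measure.map_apply (measurable_eval _) hB]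
  rfl

/-- The sandpile process is unique. -/
lemma IsSandpileProcess.eq_sandpileProcess {Q : Kernel Config PathSpace}
    (hQ : IsSandpileProcess Q) : Q = sandpileProcess := by
  have := hQ.isMarkovKernel
  ext1 η
  have h : ∀ J : Finset ℝ≥0, (Q η).map (restr J) = (sandpileProcess η).map (restr J) := fun J =>
    map_restr_mono (Finset.subset_insert 0 J)
      ((hQ.isMarkovOn η (insert 0 J)).map_restr_eq (Finset.mem_insert_self 0 J)
        (isMarkovOn_sandpileProcess (Finset.mem_insert_self 0 J) η))
  have hp : ∀ J : Finset ℝ≥0, IsFiniteMeasure ((sandpileProcess η).map (restr J)) := fun J =>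
    inferInstance
  exact IsProjectiveLimit.unique (α := fun _ : ℝ≥0 => Config)
    (P := fun J => (sandpileProcess η).map (restr J)) h fun J => rfl

lemma timeMarginal_sandpileProcess (t : ℝ≥0) : timeMarginal sandpileProcess t = transKernel t := by
  ext1 η
  rw [timeMarginal, Kernel.map_apply _ (measurable_eval t), sandpileProcess_map_eval]

/-- Run for time seven first: the law at time `7 + t` is `δ_2`, and by Chapman-Kolmogorov it is also
the law at time `t` of the process started from `δ_2`. -/
lemma transKernel_allTwo (t : ℝ≥0) : transKernel t allTwo = Measure.dirac allTwo := by
  have h := congrArg (fun κ : Kernel Config Config => κ allTwo) (transKernel_add 7 t)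
  simp only [Kernel.comp_apply] at h
  rw [transKernel_eq_dirac le_self_add, transKernel_eq_dirac le_rfl,
    Measure.dirac_bind (Kernel.measurable _)] at h
  exact h.symm

lemma isInvariantMeasure_iff (μ : Measure Config) :
    IsInvariantMeasure sandpileProcess μ ↔ μ = Measure.dirac allTwo := by
  constructor
  · rintro ⟨hμ, h⟩
    have h7 := h 7
    rw [timeMarginal_sandpileProcess, Kernel.Invariant] at h7
    -- A constant kernel sends every probability measure to `δ_2`, so invariance at the single time
    -- seven already identifies `μ`.
    have e : (transKernel 7 : Config → Measure Config) = fun _ => Measure.dirac allTwo :=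
      funext fun η => transKernel_eq_dirac le_rfl η
    rw [e, Measure.bind_const, measure_univ, one_smul] at h7
    exact h7.symm
  · rintro rfl
    refine ⟨inferInstance, fun t => ?_⟩
    rw [timeMarginal_sandpileProcess, Kernel.Invariant, Measure.dirac_bind (Kernel.measurable _),
      transKernel_allTwo]

end Sandpile

end

open Sandpile in
theorem theorem5p1 :
    ∃ P : Kernel Config PathSpace, IsSandpileProcess P ∧
      (∀ Q : Kernel Config PathSpace, IsSandpileProcess Q → Q = P) ∧
      (∃ T : ℝ≥0, 0 < T ∧ T ≤ 14 ∧ ∀ t : ℝ≥0, T ≤ t → ∀ η : Config,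
        P η {ω | (ω t 0 : ℕ) = 1} = 0 ∧
        P η {ω | ω t = allTwo} = 1 ∧
        timeMarginal P t η = Measure.dirac allTwo) ∧
      ∀ μ : Measure Config, IsInvariantMeasure P μ ↔ μ = Measure.dirac allTwo := by
  refine ⟨sandpileProcess, isSandpileProcess_sandpileProcess, fun Q hQ => hQ.eq_sandpileProcess,
    ⟨7, by norm_num, by norm_num, fun t ht η => ?_⟩, isInvariantMeasure_iff⟩
  have hlaw := (sandpileProcess_map_eval η t).trans (transKernel_eq_dirac ht η)
  have h1 : sandpileProcess η {ω | ω t = allTwo} = 1 := by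
    have := Measure.map_apply (μ := sandpileProcess η) (measurable_eval t)
      (measurableSet_singleton allTwo)
    rw [hlaw, Measure.dirac_apply_of_mem (Set.mem_singleton _)] at this
    exact this.symm
  refine ⟨?_, h1, by rw [timeMarginal_sandpileProcess, transKernel_eq_dirac ht]⟩
  have h2 := (prob_compl_eq_zero_iff (measurable_eval t (measurableSet_singleton allTwo))).2 h1
  refine measure_mono_null (t := {ω : PathSpace | ω t = allTwo}ᶜ) (fun ω hω hω' => ?_) h2
  have e : ω t = allTwo := hω'
  have hω1 : (ω t 0 : ℕ) = 1 := hω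
  rw [e] at hω1
  exact absurd hω1 (by simp [allTwo])
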